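/- **Conventions.** Let $M$ be a cancellative monoid. $g$ left-divides $h$ (written $g\preceq h$) if $h=gk$ for some $k\in M$, and right-divides $h$ if $h=kg$. The pair $(M,\Delta)$, $\Delta\in M$, is a *monoidal Garside structure* ($M$ is a *Garside monoid* with *Garside element* $\Delta$) if $M$ is noetherian for the factor relation, $M$ is a lattice for left- and for right-divisibility, $v\mapsto\Delta^{-1}v\Delta$ is an automorphism of $M$, and each atom of $M$ left-divides $\Delta$; the group of fractions of $M$ is then a *Garside group*. A submonoid $P$ of $M$ is *parabolic* with Garside element $\delta$ if $P$ is a sublattice of $M$ for left- and for right-divisibility, $\delta P=P\delta$, and $[1,\delta]=[1,\Delta]\cap P=\Delta\wedge P$, where $[1,g]$ is the set of left-divisors of $g$ in $M$ and $\wedge$ is the left gcd; the subgroup it generates is then a *(standard) parabolic subgroup*. Garside categories (categorical Garside structures) and parabolic subcategories are defined in the same way, with sets of morphisms $\mathcal C_{x\to\cdot}$, $\mathcal C_{\cdot\to x}$ of fixed source or target as lattices, and with $\Delta$ and $\delta$ natural transformations from the identity of the category, respectively from the inclusion of the subcategory $\mathcal P$, to an automorphism of the category, respectively to the inclusion composed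 with an automorphism of $\mathcal P$. Let $(A^+,\Delta)$ be a monoidal Garside structure, $S$ the set of atoms of $A^+$, and $A$ its group of fractions. For a subset $Y$ of $A^+$, write $A^+_Y$ and $A_Y$ for the submonoid of $A^+$ and the subgroup of $A$ generated by $Y$. A parabolic submonoid with atom set $X$ is written $A_X^+$, and its Garside element $\Delta_X$. The *positive ribbon category* $\mathcal R^+(A^+)$ has the parabolic submonoids of $A^+$ as objects and the elements $g\in A^+$ with $g^{-1}A_X^+g=A_Y^+$ as morphisms from $A_X^+$ to $A_Y^+$; the *ribbon groupoid* $\mathcal R(A)$ has the standard parabolic subgroups $A_X$ as objects and the elements $g\in A$ with $g^{-1}A_X^+g=A_Y^+$ as morphisms from $A_X$ to $A_Y$; composition is the product of $A$. A *standard parabolic subgroupoid* of $\mathcal R(A)$ is a subgroupoid generated by a parabolic subcategory of $\mathcal R^+(A^+)$. A *$\nu$-structure* on $A^+$ consists of maps $\nu_X:S\to\mathcal R^+(A^+)_{A_X^+\to\cdot}$ and $\tilde\nu_X:S\to\mathcal R^+(A^+)_{\cdot\to A_X^+}$ for each parabolic submonoid $A_X^+$, such that for all $s,t\in S$: $\nu_X(s)$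 is an atom of $\mathcal R^+(A^+)$; if $s$ left-divides $g\in\mathcal R^+(A^+)_{A_X^+\to\cdot}$ then $\nu_X(s)$ left-divides $g$; the left lcm of $\nu_X(s)$ and $\nu_X(t)$ in $A^+$ lies in $\mathcal R^+(A^+)_{A_X^+\to\cdot}$; and symmetrically for $\tilde\nu_X$, with right-divisibility and $\mathcal R^+(A^+)_{\cdot\to A_X^+}$. Set $$\mathrm{SH}(X)=\{\nu_X(s)\mid s\in S,\ \nu_X(s)\in\mathcal R(A)_{A_X\to A_X}\},\qquad \mathrm{SH}^\nu(X)=\mathrm{SH}(X)\setminus A_X^+,$$ $$\mathrm{sh}(X)=\nu_X^{-1}(\mathrm{SH}(X)),\qquad \widetilde{\mathrm{sh}}(X)=\tilde\nu_X^{-1}(\mathrm{SH}(X)),$$ and $\mathrm{QZ}(A_X)=\{g\in A_X\mid gA_X^+=A_X^+g\}$. **Theorem.** Let $(A^+,\Delta)$ be a monoidal Garside structure with a $\nu$-structure, and let $A_X^+$ be a parabolic submonoid of $A^+$ such that $\mathrm{sh}(X)=\widetilde{\mathrm{sh}}(X)$. Assume that $A^+_{\mathrm{sh}(X)}$ is a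 parabolic submonoid of $A^+$, with Garside element $\Delta_{\mathrm{sh}(X)}$. Then: (i) The category $\mathcal R^+(A^+)$, with $\Delta$ as its natural transformation, is a Garside category, and $A_{\mathrm{SH}(X)}$ is a standard parabolic subgroup(oid) of $\mathcal R(A)$ with $A_X$ as unique object: it is generated by a parabolic subcategory of $\mathcal R^+(A^+)$ with unique object $A_X^+$, vertex monoid $A^+_{\mathrm{SH}(X)}$ and Garside element $\Delta_{\mathrm{sh}(X)}$. In particular $A_{\mathrm{SH}(X)}$ is a Garside group, with Garside monoid $A^+_{\mathrm{SH}(X)}$; the Garside element of this monoid is $\Delta_{\mathrm{sh}(X)}$ and its atom set is $\mathrm{SH}(X)$. (ii) Write $\Delta_{\mathrm{sh}(X)}=\Delta_X\nabla_X$. Then $A_{\mathrm{SH}^\nu(X)}$ is a standard parabolic subgroup of $A_{\mathrm{SH}(X)}$ (generated by the parabolic submonoid $A^+_{\mathrm{SH}^\nu(X)}$ of $A^+_{\mathrm{SH}(X)}$) with Garside element $\nabla_X$, and $$A_{\mathrm{SH}(X)}=\mathrm{QZ}(A_X)\rtimes A_{\mathrm{SH}^\nu(X)}.$$ -/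

import Mathlib

open CategoryTheory

universe u v

/-! ### Garside monoids and parabolic submonoids

A Garside monoid embeds in its group of fractions, and we work inside that group: a monoid is a
submonoid `B` of a group `G`, so cancellativity is automatic. -/

section Monoidal

variable {G : Type u} [Group G]

/-- `g` left-divides `h` in `B`: `h = g * k` with `k ∈ B`. -/
def LeftDivides (B : Submonoid G) (g h : G) : Prop := ∃ k ∈ B, h = g * k

/-- `g` right-divides `h` in `B`: `h = k * g` with `k ∈ B`. -/
def RightDivides (B : Submonoid G) (g h : G) : Prop := ∃ k ∈ B, h = k * g

/-- `l` is the least common multiple of `g` and `h` in `B` for left-divisibility. -/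
def IsLeftLcm (B : Submonoid G) (g h l : G) : Prop :=
  l ∈ B ∧ LeftDivides B g l ∧ LeftDivides B h l ∧
    ∀ m ∈ B, LeftDivides B g m → LeftDivides B h m → LeftDivides B l m

/-- `d` is the greatest common divisor of `g` and `h` in `B` for left-divisibility. -/
def IsLeftGcd (B : Submonoid G) (g h d : G) : Prop :=
  d ∈ B ∧ LeftDivides B d g ∧ LeftDivides B d h ∧
    ∀ m ∈ B, LeftDivides B m g → LeftDivides B m h → LeftDivides B m d

/-- `l` is the least common multiple of `g` and `h` in `B` for right-divisibility. -/
def IsRightLcm (B : Submonoid G) (g h l : G) : Prop :=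
  l ∈ B ∧ RightDivides B g l ∧ RightDivides B h l ∧
    ∀ m ∈ B, RightDivides B g m → RightDivides B h m → RightDivides B l m

/-- `d` is the greatest common divisor of `g` and `h` in `B` for right-divisibility. -/
def IsRightGcd (B : Submonoid G) (g h d : G) : Prop :=
  d ∈ B ∧ RightDivides B d g ∧ RightDivides B d h ∧
    ∀ m ∈ B, RightDivides B m g → RightDivides B m h → RightDivides B m d

/-- The atom set of the monoid `B`. -/
def atomSet (B : Submonoid G) : Set G :=
  {s | s ∈ B ∧ s ≠ 1 ∧ ∀ a ∈ B, ∀ b ∈ B, s = a * b → a = 1 ∨ b = 1}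

/-- `g⁻¹ P g = Q`. -/
def ConjTo (g : G) (P Q : Submonoid G) : Prop := ∀ x, x ∈ P ↔ g⁻¹ * x * g ∈ Q

/-- `(B, Δ)` is a monoidal Garside structure.  The automorphism of `B` induced by `Δ` is
`v ↦ Δ⁻¹ * v * Δ`. -/
structure IsGarsideMonoid (B : Submonoid G) (Δ : G) : Prop where
  delta_mem : Δ ∈ B
  delta_conj : ConjTo Δ B B
  noetherian : ∀ w : ℕ → G, (∀ i, w i ∈ B) →
    (∀ i, ∃ a ∈ B, ∃ b ∈ B, w i = a * w (i + 1) * b) → ∃ N, ∀ i, N ≤ i → w i = w N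
  left_lcm : ∀ g ∈ B, ∀ h ∈ B, ∃ l, IsLeftLcm B g h l
  left_gcd : ∀ g ∈ B, ∀ h ∈ B, ∃ d, IsLeftGcd B g h d
  right_lcm : ∀ g ∈ B, ∀ h ∈ B, ∃ l, IsRightLcm B g h l
  right_gcd : ∀ g ∈ B, ∀ h ∈ B, ∃ d, IsRightGcd B g h d
  atom_dvd : ∀ s ∈ atomSet B, LeftDivides B s Δ

/-- `H` is a Garside group with Garside monoid `B` and Garside element `Δ`: the pair `(B, Δ)` is a
monoidal Garside structure and `H` is the group of fractions of `B`. -/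
structure IsGarsideGroup (H : Subgroup G) (B : Submonoid G) (Δ : G) : Prop where
  garside : IsGarsideMonoid B Δ
  le : B ≤ H.toSubmonoid
  fraction : ∀ g ∈ H, ∃ a ∈ B, ∃ b ∈ B, g = a * b⁻¹

/-- `P` is a parabolic submonoid of the Garside monoid `(B, Δ)`, with Garside element `δ`: it is a
sublattice for both divisibilities, `δ` normalizes `P`, and `[1, δ] = [1, Δ] ∩ P = Δ ∧ P`. -/
structure IsParabolicWith (B : Submonoid G) (Δ : G) (P : Submonoid G) (δ : G) : Prop where
  le : P ≤ B
  left_lcm_mem : ∀ g ∈ P, ∀ h ∈ P, ∀ l, IsLeftLcm B g h l → l ∈ P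
  left_gcd_mem : ∀ g ∈ P, ∀ h ∈ P, ∀ d, IsLeftGcd B g h d → d ∈ P
  right_lcm_mem : ∀ g ∈ P, ∀ h ∈ P, ∀ l, IsRightLcm B g h l → l ∈ P
  right_gcd_mem : ∀ g ∈ P, ∀ h ∈ P, ∀ d, IsRightGcd B g h d → d ∈ P
  delta_mem : δ ∈ B
  delta_conj : ConjTo δ P P
  interval_eq_inter : {g | g ∈ B ∧ LeftDivides B g δ} = {g | g ∈ B ∧ LeftDivides B g Δ} ∩ P
  interval_eq_gcd : {g | g ∈ B ∧ LeftDivides B g δ} = {g | ∃ p ∈ P, IsLeftGcd B Δ p g}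

/-- `P` is a parabolic submonoid of the Garside monoid `(B, Δ)`. -/
def IsParabolic (B : Submonoid G) (Δ : G) (P : Submonoid G) : Prop :=
  ∃ δ, IsParabolicWith B Δ P δ

/-- `H` is the standard parabolic subgroup, with Garside element `δ`, generated by a parabolic
submonoid `P` of `(B, Δ)`. -/
def IsStandardParabolicSubgroup (B : Submonoid G) (Δ : G) (H : Subgroup G) (P : Submonoid G)
    (δ : G) : Prop :=
  IsParabolicWith B Δ P δ ∧ H = Subgroup.closure (P : Set G)

/-- The quasi-centralizer `QZ(H) = {g ∈ H | g B = B g}` of the Garside group `H` generated by the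
Garside monoid `B`. -/
def quasiCentralizer (B : Submonoid G) : Subgroup G where
  carrier := {g | g ∈ Subgroup.closure (B : Set G) ∧ ConjTo g B B}
  one_mem' := ⟨one_mem _, fun x => by simp⟩
  mul_mem' := by
    rintro a b ⟨ha, ha'⟩ ⟨hb, hb'⟩
    refine ⟨mul_mem ha hb, fun x => ?_⟩
    rw [ha' x, hb' (a⁻¹ * x * a)]
    simp only [mul_inv_rev, mul_assoc]
  inv_mem' := by
    rintro a ⟨ha, ha'⟩
    refine ⟨inv_mem ha, fun x => ?_⟩
    rw [ha' (a⁻¹⁻¹ * x * a⁻¹)]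
    simp [mul_assoc]

/-- `H = N ⋊ K` as an internal semi-direct product of subgroups. -/
def IsInternalSemidirect (H N K : Subgroup G) : Prop :=
  N ≤ H ∧ K ≤ H ∧ (N.subgroupOf H).Normal ∧
    Subgroup.IsComplement' (N.subgroupOf H) (K.subgroupOf H)

end Monoidal

/-! ### Garside categories and parabolic subcategories -/

section Categorical

variable {C : Type u} [Category.{v} C]

/-- The functor `Φ` is an automorphism (an isomorphism of categories, not just an equivalence). -/
def IsCatAut {D : Type*} [Category D] (Φ : D ⥤ D) : Prop :=
  ∃ Ψ : D ⥤ D, Φ ⋙ Ψ = 𝟭 D ∧ Ψ ⋙ Φ = 𝟭 D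

/-- `f` is an identity morphism. -/
def IsIdentity {x y : C} (f : x ⟶ y) : Prop := ∃ h : x = y, f = eqToHom h

/-- `f` is an atom of the category. -/
def IsAtomHom {x y : C} (f : x ⟶ y) : Prop :=
  ¬ IsIdentity f ∧ ∀ (z : C) (a : x ⟶ z) (b : z ⟶ y), f = a ≫ b → IsIdentity a ∨ IsIdentity b

/-- Left-divisibility in `C_{x→·}`. -/
def CatLeftDivides {x y z : C} (g : x ⟶ y) (h : x ⟶ z) : Prop := ∃ k : y ⟶ z, h = g ≫ k

/-- Right-divisibility in `C_{·→x}`. -/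
def CatRightDivides {x y z : C} (g : y ⟶ x) (h : z ⟶ x) : Prop := ∃ k : z ⟶ y, h = k ≫ g

/-- Least common multiple in `C_{x→·}`. -/
def IsCatLeftLcm {x y z w : C} (g : x ⟶ y) (h : x ⟶ z) (l : x ⟶ w) : Prop :=
  CatLeftDivides g l ∧ CatLeftDivides h l ∧
    ∀ (t : C) (m : x ⟶ t), CatLeftDivides g m → CatLeftDivides h m → CatLeftDivides l m

/-- Greatest common divisor in `C_{x→·}`. -/
def IsCatLeftGcd {x y z w : C} (g : x ⟶ y) (h : x ⟶ z) (d : x ⟶ w) : Prop :=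
  CatLeftDivides d g ∧ CatLeftDivides d h ∧
    ∀ (t : C) (m : x ⟶ t), CatLeftDivides m g → CatLeftDivides m h → CatLeftDivides m d

/-- Least common multiple in `C_{·→x}`. -/
def IsCatRightLcm {x y z w : C} (g : y ⟶ x) (h : z ⟶ x) (l : w ⟶ x) : Prop :=
  CatRightDivides g l ∧ CatRightDivides h l ∧
    ∀ (t : C) (m : t ⟶ x), CatRightDivides g m → CatRightDivides h m → CatRightDivides l m

/-- Greatest common divisor in `C_{·→x}`. -/
def IsCatRightGcd {x y z w : C} (g : y ⟶ x) (h : z ⟶ x) (d : w ⟶ x) : Prop :=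
  CatRightDivides d g ∧ CatRightDivides d h ∧
    ∀ (t : C) (m : t ⟶ x), CatRightDivides m g → CatRightDivides m h → CatRightDivides m d

variable (C) in
/-- A categorical Garside structure `(C, Δ)`. -/
structure CatGarsideStructure where
  Φ : C ⥤ C
  isCatAut : IsCatAut Φ
  Δ : 𝟭 C ⟶ Φ
  left_cancel : ∀ {x y z : C} (f : x ⟶ y) (g h : y ⟶ z), f ≫ g = f ≫ h → g = h
  right_cancel : ∀ {x y z : C} (f : y ⟶ z) (g h : x ⟶ y), g ≫ f = h ≫ f → g = h
  noetherian : ∀ w : ℕ → Arrow C,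
    (∀ i, ∃ (a : (w i).left ⟶ (w (i + 1)).left) (b : (w (i + 1)).right ⟶ (w i).right),
      (w i).hom = a ≫ (w (i + 1)).hom ≫ b) → ∃ N, ∀ i, N ≤ i → w i = w N
  left_lcm : ∀ {x y z : C} (g : x ⟶ y) (h : x ⟶ z), ∃ (w : C) (l : x ⟶ w), IsCatLeftLcm g h l
  left_gcd : ∀ {x y z : C} (g : x ⟶ y) (h : x ⟶ z), ∃ (w : C) (d : x ⟶ w), IsCatLeftGcd g h d
  right_lcm : ∀ {x y z : C} (g : y ⟶ x) (h : z ⟶ x), ∃ (w : C) (l : w ⟶ x), IsCatRightLcm g h l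
  right_gcd : ∀ {x y z : C} (g : y ⟶ x) (h : z ⟶ x), ∃ (w : C) (d : w ⟶ x), IsCatRightGcd g h d
  atom_dvd : ∀ {x y : C} (f : x ⟶ y), IsAtomHom f →
    ∃ k : y ⟶ Φ.obj x, f ≫ k = Δ.app x ∧ k ≫ Φ.map f = Δ.app y

variable (C) in
/-- A (not necessarily full, not necessarily wide) subcategory of `C`. -/
structure SubCat where
  objs : Set C
  arrows : ∀ x y : C, Set (x ⟶ y)
  mem_objs : ∀ {x y : C} {f : x ⟶ y}, f ∈ arrows x y → x ∈ objs ∧ y ∈ objs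
  id_mem : ∀ {x : C}, x ∈ objs → 𝟙 x ∈ arrows x x
  comp_mem : ∀ {x y z : C} {f : x ⟶ y} {g : y ⟶ z},
    f ∈ arrows x y → g ∈ arrows y z → f ≫ g ∈ arrows x z

namespace SubCat

/-- The objects of a subcategory, as a type. -/
structure Obj (𝒟 : SubCat C) where
  pt : C
  mem : pt ∈ 𝒟.objs

instance (𝒟 : SubCat C) : Category 𝒟.Obj where
  Hom x y := {f : x.pt ⟶ y.pt // f ∈ 𝒟.arrows x.pt y.pt}
  id x := ⟨𝟙 x.pt, 𝒟.id_mem x.mem⟩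
  comp f g := ⟨f.1 ≫ g.1, 𝒟.comp_mem f.2 g.2⟩

/-- The canonical functor from a subcategory to the category. -/
def incl (𝒟 : SubCat C) : 𝒟.Obj ⥤ C where
  obj x := x.pt
  map f := f.1

/-- `𝒟` is a parabolic subcategory of the Garside category `(C, Δ)` with Garside map `δ`: for each
object it is a sublattice for both divisibilities, `δ` is a natural transformation from the
canonical functor to its composite with an automorphism `φ` of `𝒟`, and
`[1, δ x] = [1, Δ x] ∩ 𝒟_{x→·} = Δ x ∧ 𝒟_{x→·}` for each object `x` of `𝒟`. -/
structure IsParabolicWith (𝓖 : CatGarsideStructure C) (𝒟 : SubCat C) (φ : 𝒟.Obj ⥤ 𝒟.Obj)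
    (δ : 𝒟.incl ⟶ φ ⋙ 𝒟.incl) : Prop where
  left_lcm_mem : ∀ {x y z w : C}, ∀ g ∈ 𝒟.arrows x y, ∀ h ∈ 𝒟.arrows x z, ∀ l : x ⟶ w,
    IsCatLeftLcm g h l → l ∈ 𝒟.arrows x w
  left_gcd_mem : ∀ {x y z w : C}, ∀ g ∈ 𝒟.arrows x y, ∀ h ∈ 𝒟.arrows x z, ∀ d : x ⟶ w,
    IsCatLeftGcd g h d → d ∈ 𝒟.arrows x w
  right_lcm_mem : ∀ {x y z w : C}, ∀ g ∈ 𝒟.arrows y x, ∀ h ∈ 𝒟.arrows z x, ∀ l : w ⟶ x,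
    IsCatRightLcm g h l → l ∈ 𝒟.arrows w x
  right_gcd_mem : ∀ {x y z w : C}, ∀ g ∈ 𝒟.arrows y x, ∀ h ∈ 𝒟.arrows z x, ∀ d : w ⟶ x,
    IsCatRightGcd g h d → d ∈ 𝒟.arrows w x
  isCatAut : IsCatAut φ
  interval_iff_inter : ∀ (x : 𝒟.Obj) (y : C) (g : x.pt ⟶ y),
    CatLeftDivides g (δ.app x) ↔ (CatLeftDivides g (𝓖.Δ.app x.pt) ∧ g ∈ 𝒟.arrows x.pt y)
  interval_iff_gcd : ∀ (x : 𝒟.Obj) (y : C) (g : x.pt ⟶ y),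
    CatLeftDivides g (δ.app x) ↔
      ∃ (z : C) (h : x.pt ⟶ z), h ∈ 𝒟.arrows x.pt z ∧ IsCatLeftGcd (𝓖.Δ.app x.pt) h g

/-- The subgroupoid generated by the image of a subcategory under a functor to a groupoid. -/
def generatedSubgroupoid {D : Type*} [Groupoid D] (F : C ⥤ D) (𝒟 : SubCat C) : Subgroupoid D :=
  sInf {𝒮 | ∀ (x y : C), ∀ f ∈ 𝒟.arrows x y, F.map f ∈ 𝒮.arrows (F.obj x) (F.obj y)}

end SubCat

end Categorical

/-! ### The positive ribbon category, the ribbon groupoid and `ν`-structures -/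

section Ribbon

variable {G : Type u} [Group G]

/-- The objects of the positive ribbon category of the Garside monoid `(B, Δ)`: the parabolic
submonoids. -/
@[ext]
structure PosRibbon (B : Submonoid G) (Δ : G) where
  carrier : Submonoid G
  isParabolic : IsParabolic B Δ carrier

namespace PosRibbon

variable {B : Submonoid G} {Δ : G}

/-- Morphisms of the positive ribbon category: the elements `g` of `B` with `g⁻¹ P g = Q`. -/
@[ext]
structure Hom (P Q : PosRibbon B Δ) where
  val : G
  mem : val ∈ B
  conj : ConjTo val P.carrier Q.carrier

/-- The positive ribbon category; the composite `f ≫ g` is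
the product `f * g`. -/
instance : Category (PosRibbon B Δ) where
  Hom P Q := Hom P Q
  id P := ⟨1, one_mem _, fun x => by simp⟩
  comp f g := ⟨f.val * g.val, mul_mem f.mem g.mem, fun x => by
    rw [f.conj x, g.conj (f.val⁻¹ * x * f.val)]
    simp only [mul_inv_rev, mul_assoc]⟩
  id_comp f := by apply Hom.ext; simp
  comp_id f := by apply Hom.ext; simp
  assoc f g h := by apply Hom.ext; simp [mul_assoc]

/-- The element of `G` underlying a positive ribbon. -/
def elt {P Q : PosRibbon B Δ} (f : P ⟶ Q) : G := Hom.val f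

end PosRibbon

/-- The objects of the ribbon groupoid: the standard parabolic subgroups.  The subgroup generated
by the parabolic submonoid `P` is represented by `P`, which is its intersection with `B`. -/
structure Ribbon (B : Submonoid G) (Δ : G) where
  pos : PosRibbon B Δ

namespace Ribbon

variable {B : Submonoid G} {Δ : G}

/-- Ribbons: the elements `g` of the group with `g⁻¹ P g = Q`; they also conjugate the subgroup
generated by `P` to the subgroup generated by `Q`. -/
@[ext]
structure Hom (P Q : Ribbon B Δ) where
  val : G
  conj : ConjTo val P.pos.carrier Q.pos.carrier

/-- The ribbon groupoid. -/
instance : Groupoid (Ribbon B Δ) where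
  Hom P Q := Hom P Q
  id P := ⟨1, fun x => by simp⟩
  comp f g := ⟨f.val * g.val, fun x => by
    rw [f.conj x, g.conj (f.val⁻¹ * x * f.val)]
    simp only [mul_inv_rev, mul_assoc]⟩
  id_comp f := by apply Hom.ext; simp
  comp_id f := by apply Hom.ext; simp
  assoc f g h := by apply Hom.ext; simp [mul_assoc]
  inv f := ⟨f.val⁻¹, fun x => by
    rw [f.conj (f.val⁻¹⁻¹ * x * f.val⁻¹)]
    simp [mul_assoc]⟩
  inv_comp f := by apply Hom.ext; simp
  comp_inv f := by apply Hom.ext; simp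

/-- The element of `G` underlying a ribbon. -/
def elt {P Q : Ribbon B Δ} (f : P ⟶ Q) : G := Hom.val f

/-- The canonical functor from the positive ribbon category to the ribbon groupoid. -/
def ofPos (B : Submonoid G) (Δ : G) : PosRibbon B Δ ⥤ Ribbon B Δ where
  obj P := ⟨P⟩
  map f := ⟨PosRibbon.Hom.val f, PosRibbon.Hom.conj f⟩

end Ribbon

/-- The subgroup `H` is a standard parabolic subgroup of the ribbon groupoid with unique object
(the subgroup generated by) `X`, with positive part `P` and Garside element `d`: it is the
subgroupoid generated by a parabolic subcategory of the positive ribbon category that has `X` as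
unique object, vertex monoid `P` and Garside map `d`. -/
def IsStandardParabolicInRibbon {B : Submonoid G} {Δ : G}
    (𝓖 : CatGarsideStructure (PosRibbon B Δ)) (X : PosRibbon B Δ) (H : Subgroup G)
    (P : Submonoid G) (d : G) : Prop :=
  ∃ (𝒟 : SubCat (PosRibbon B Δ)) (φ : 𝒟.Obj ⥤ 𝒟.Obj) (δ : 𝒟.incl ⟶ φ ⋙ 𝒟.incl),
    𝒟.IsParabolicWith 𝓖 φ δ ∧
    𝒟.objs = {X} ∧
    PosRibbon.elt '' 𝒟.arrows X X = (P : Set G) ∧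
    (∀ x : 𝒟.Obj, PosRibbon.elt (δ.app x) = d) ∧
    (𝒟.generatedSubgroupoid (Ribbon.ofPos B Δ)).objs = {(Ribbon.ofPos B Δ).obj X} ∧
    Ribbon.elt '' (𝒟.generatedSubgroupoid (Ribbon.ofPos B Δ)).arrows
      ((Ribbon.ofPos B Δ).obj X) ((Ribbon.ofPos B Δ).obj X) = (H : Set G)

/-- A `ν`-function on the Garside monoid `(B, Δ)`.  Only the values `nu P s` at atoms `s` of `B`
matter. -/
structure NuFunction (B : Submonoid G) (Δ : G) where
  nu : PosRibbon B Δ → G → G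
  atom : ∀ P, ∀ s ∈ atomSet B, ∃ (Q : PosRibbon B Δ) (f : P ⟶ Q),
    PosRibbon.elt f = nu P s ∧ IsAtomHom f
  dvd : ∀ P, ∀ s ∈ atomSet B, ∀ (Q : PosRibbon B Δ) (g : P ⟶ Q),
    LeftDivides B s (PosRibbon.elt g) → LeftDivides B (nu P s) (PosRibbon.elt g)
  lcm : ∀ P, ∀ s ∈ atomSet B, ∀ t ∈ atomSet B, ∀ l, IsLeftLcm B (nu P s) (nu P t) l →
    ∃ (Q : PosRibbon B Δ) (f : P ⟶ Q), PosRibbon.elt f = l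

/-- A `ν̃`-function on the Garside monoid `(B, Δ)`.  Only the values `nu P s` at atoms `s` of `B`
matter. -/
structure NuTildeFunction (B : Submonoid G) (Δ : G) where
  nu : PosRibbon B Δ → G → G
  atom : ∀ P, ∀ s ∈ atomSet B, ∃ (Q : PosRibbon B Δ) (f : Q ⟶ P),
    PosRibbon.elt f = nu P s ∧ IsAtomHom f
  dvd : ∀ P, ∀ s ∈ atomSet B, ∀ (Q : PosRibbon B Δ) (g : Q ⟶ P),
    RightDivides B s (PosRibbon.elt g) → RightDivides B (nu P s) (PosRibbon.elt g)
  lcm : ∀ P, ∀ s ∈ atomSet B, ∀ t ∈ atomSet B, ∀ l, IsRightLcm B (nu P s) (nu P t) l →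
    ∃ (Q : PosRibbon B Δ) (f : Q ⟶ P), PosRibbon.elt f = l

/-- A `ν`-structure: a `ν`-function together with a `ν̃`-function. -/
structure NuStructure (B : Submonoid G) (Δ : G) where
  left : NuFunction B Δ
  right : NuTildeFunction B Δ

namespace NuStructure

variable {B : Submonoid G} {Δ : G} (N : NuStructure B Δ) (X : PosRibbon B Δ)

/-- The shakers `SH(X)`: the `ν_X(s)`, `s` an atom, that are ribbons from `X` to `X`. -/
def SH : Set G :=
  {g | ∃ s ∈ atomSet B, g = N.left.nu X s ∧ ConjTo g X.carrier X.carrier}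

/-- The shakers `SH^ν(X)`: those that do not lie in the parabolic submonoid itself. -/
def SHnu : Set G := {g | g ∈ N.SH X ∧ g ∉ X.carrier}

/-- `sh(X)`, the preimage of `SH(X)` under `ν_X`. -/
def sh : Set G := {s | s ∈ atomSet B ∧ N.left.nu X s ∈ N.SH X}

/-- The preimage of `SH(X)` under `ν̃_X`. -/
def shTilde : Set G := {s | s ∈ atomSet B ∧ N.right.nu X s ∈ N.SH X}

end NuStructure

end Ribbon

/-! ### Divisibility and lcm/gcd calculus in a submonoid of a group. -/

section Monoidal

variable {G : Type u} [Group G]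

/-! Ribbons with source `X` are stable under left gcds and lcms: the elements `ν_X(s)` can be peeled
off from the left, and noetherianity makes the induction end. Complementing in a power of `Δ`
exchanges left and right, so right gcds and lcms follow. Hence the lattice operations of the ribbon
category are those of the ambient monoid, and the category is Garside
(`PosRibbon.garsideStructure`).

For (i), the key is `mem_closure_SH_iff`: the monoid generated by `SH(X)` is the set of elements of
the parabolic monoid generated by `sh(X)` that normalize `X`. A ribbon from `X` inside the latter
monoid can only begin with shakers, and a shaker leads back to `X`. So `A^+_{SH(X)}` inherits
quotients, lcms, gcds and its Garside element from the parabolic monoid. This uses that parabolic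
submonoids contain all factors of their elements (`IsParabolicWith.factorClosed`).

For (ii), call an element reduced if it has no nontrivial left-divisor in `X`. Since shakers
normalize `X`, reduced elements of `A^+_{SH(X)}` form a monoid, generated by the shakers outside `X`
(`mem_closure_SHnu_iff`). The lcm of a reduced normalizing `g` and of `x` in `X` is `x * g`; this
makes `∇ = Δ_X⁻¹ δ` the Garside element of the reduced monoid and shows that `Δ_X` commutes with it.
Shakers in `X` lie in `QZ(A_X)`, which gives generation. Comparing the `X`-parts of two fractions
gives trivial intersection. -/

theorem leftDivides_iff {B : Submonoid G} {g h : G} : LeftDivides B g h ↔ g⁻¹ * h ∈ B :=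
  ⟨by rintro ⟨k, hk, rfl⟩; simpa using hk, fun hk => ⟨_, hk, by simp⟩⟩

theorem rightDivides_iff {B : Submonoid G} {g h : G} : RightDivides B g h ↔ h * g⁻¹ ∈ B :=
  ⟨by rintro ⟨k, hk, rfl⟩; simpa using hk, fun hk => ⟨_, hk, by simp⟩⟩

theorem LeftDivides.refl (B : Submonoid G) (g : G) : LeftDivides B g g :=
  ⟨1, one_mem _, by simp⟩

theorem LeftDivides.trans {B : Submonoid G} {a b c : G} (hab : LeftDivides B a b)
    (hbc : LeftDivides B b c) : LeftDivides B a c := by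
  rw [leftDivides_iff] at *
  simpa [mul_assoc] using mul_mem hab hbc

theorem LeftDivides.mono {B C : Submonoid G} (hBC : B ≤ C) {g h : G} (hd : LeftDivides B g h) :
    LeftDivides C g h :=
  let ⟨k, hk, e⟩ := hd; ⟨k, hBC hk, e⟩

theorem leftDivides_mul_right {B : Submonoid G} {g k : G} (hk : k ∈ B) :
    LeftDivides B g (g * k) := ⟨k, hk, rfl⟩

theorem one_leftDivides {B : Submonoid G} {g : G} (hg : g ∈ B) : LeftDivides B 1 g :=
  ⟨g, hg, by simp⟩

theorem leftDivides_mul_left_iff {B : Submonoid G} (c : G) {g h : G} :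
    LeftDivides B (c * g) (c * h) ↔ LeftDivides B g h := by
  simp [leftDivides_iff, mul_assoc]

theorem inv_mul_leftDivides_iff {B : Submonoid G} {c g h : G} :
    LeftDivides B (c⁻¹ * g) h ↔ LeftDivides B g (c * h) := by
  simp [leftDivides_iff, mul_assoc]

theorem leftDivides_inv_mul_iff {B : Submonoid G} {c g h : G} :
    LeftDivides B g (c⁻¹ * h) ↔ LeftDivides B (c * g) h := by
  simp [leftDivides_iff, mul_assoc]

theorem IsLeftLcm.inv_mul {B : Submonoid G} {c f g l : G} (hl : IsLeftLcm B f g l) (hc : c ∈ B)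
    (hf : LeftDivides B c f) : IsLeftLcm B (c⁻¹ * f) (c⁻¹ * g) (c⁻¹ * l) := by
  refine ⟨leftDivides_iff.1 (hf.trans hl.2.1), (leftDivides_mul_left_iff _).2 hl.2.1,
    (leftDivides_mul_left_iff _).2 hl.2.2.1, fun m hm h₁ h₂ => ?_⟩
  rw [inv_mul_leftDivides_iff] at *
  exact hl.2.2.2 _ (mul_mem hc hm) h₁ h₂

theorem IsLeftGcd.inv_mul {B : Submonoid G} {c f g d : G} (hd : IsLeftGcd B f g d) (hc : c ∈ B)
    (hf : LeftDivides B c f) (hg : LeftDivides B c g) :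
    IsLeftGcd B (c⁻¹ * f) (c⁻¹ * g) (c⁻¹ * d) := by
  refine ⟨leftDivides_iff.1 (hd.2.2.2 c hc hf hg), (leftDivides_mul_left_iff _).2 hd.2.1,
    (leftDivides_mul_left_iff _).2 hd.2.2.1, fun m hm h₁ h₂ => ?_⟩
  rw [leftDivides_inv_mul_iff] at *
  exact hd.2.2.2 _ (mul_mem hc hm) h₁ h₂

/-! ### Conjugation -/

theorem ConjTo.one (P : Submonoid G) : ConjTo 1 P P := fun x => by simp

theorem ConjTo.mul {a b : G} {P Q R : Submonoid G} (ha : ConjTo a P Q) (hb : ConjTo b Q R) :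
    ConjTo (a * b) P R := fun x => by
  rw [ha x, hb (a⁻¹ * x * a)]
  simp only [mul_inv_rev, mul_assoc]

theorem ConjTo.inv {a : G} {P Q : Submonoid G} (ha : ConjTo a P Q) : ConjTo a⁻¹ Q P := fun x => by
  rw [ha (a⁻¹⁻¹ * x * a⁻¹)]
  simp [mul_assoc]

theorem ConjTo.inv_mul {a b : G} {P Q R : Submonoid G} (ha : ConjTo a P Q) (hb : ConjTo b P R) :
    ConjTo (a⁻¹ * b) Q R := ha.inv.mul hb

theorem ConjTo.mul_inv {a b : G} {P Q R : Submonoid G} (ha : ConjTo a P R) (hb : ConjTo b Q R) :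
    ConjTo (a * b⁻¹) P Q := ha.mul hb.inv

theorem ConjTo.pow {a : G} {P : Submonoid G} (ha : ConjTo a P P) (n : ℕ) : ConjTo (a ^ n) P P := by
  induction n with
  | zero => simpa using ConjTo.one P
  | succ n ih => rw [pow_succ]; exact ih.mul ha

theorem ConjTo.mem {a x : G} {P Q : Submonoid G} (ha : ConjTo a P Q) (hx : x ∈ P) :
    a⁻¹ * x * a ∈ Q := (ha x).1 hx

theorem ConjTo.mem' {a x : G} {P Q : Submonoid G} (ha : ConjTo a P Q) (hx : x ∈ Q) :
    a * x * a⁻¹ ∈ P := by simpa using ha.inv.mem hx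

theorem ConjTo.unique {a : G} {P Q R : Submonoid G} (h₁ : ConjTo a P Q) (h₂ : ConjTo a P R) :
    Q = R := by
  ext x
  have := (h₁ (a * x * a⁻¹)).symm.trans (h₂ (a * x * a⁻¹))
  simpa [mul_assoc] using this

theorem ConjTo.eq_of_one {P Q : Submonoid G} (h : ConjTo 1 P Q) : P = Q :=
  (ConjTo.one P).unique h

/-- The conjugate submonoid `c⁻¹ P c`. -/
def conjSubmonoid (c : G) (P : Submonoid G) : Submonoid G :=
  P.comap (MulAut.conj c).toMonoidHom

theorem mem_conjSubmonoid {c x : G} {P : Submonoid G} :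
    x ∈ conjSubmonoid c P ↔ c * x * c⁻¹ ∈ P := Iff.rfl

theorem conjTo_conjSubmonoid (c : G) (P : Submonoid G) : ConjTo c P (conjSubmonoid c P) :=
  fun x => by simp [mem_conjSubmonoid, mul_assoc]

/-- Divisors of an element that normalizes the monoid are the same on both sides. -/
theorem ConjTo.leftDivides_iff_rightDivides {P : Submonoid G} {δ g : G} (hδ : ConjTo δ P P) :
    LeftDivides P g δ ↔ RightDivides P g δ := by
  rw [leftDivides_iff, rightDivides_iff, hδ (δ * g⁻¹)]
  simp

/-! ### Garside monoids -/

namespace IsGarsideMonoid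

variable {B : Submonoid G} {Δ : G} (hB : IsGarsideMonoid B Δ)
include hB

/-- In the alternating sequence `w, w * b, w, w * b, ...` every term is a factor of the preceding
one, so noetherianity makes it constant. It follows that there are no units and that divisibility is
antisymmetric. -/
theorem eq_one_of_eq_mul_mul {a b w : G} (ha : a ∈ B) (hb : b ∈ B) (hw : w ∈ B)
    (e : w = a * w * b) : a = 1 ∧ b = 1 := by
  have key : b = 1 := by
    obtain ⟨n, hn⟩ := hB.noetherian (fun i => if Even i then w else w * b)
      (fun i => by split_ifs; exacts [hw, mul_mem hw hb])
      (fun i => by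
        by_cases hi : Even i
        · have : ¬ Even (i + 1) := by simpa [Nat.even_add_one] using hi
          simp only [hi, this, if_true, if_false]
          exact ⟨a, ha, 1, one_mem _, by simpa [mul_assoc] using e⟩
        · have : Even (i + 1) := by simpa [Nat.even_add_one] using hi
          simp only [hi, this, if_true, if_false]
          exact ⟨1, one_mem _, b, hb, by simp⟩)
    have h₁ := hn (n + 1) (by omega)
    by_cases hi : Even n
    · have : ¬ Even (n + 1) := by simpa [Nat.even_add_one] using hi
      simpa [hi, this] using h₁
    · have : Even (n + 1) := by simpa [Nat.even_add_one] using hi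
      simpa [hi, this] using h₁
  subst key
  exact ⟨by simpa using e, rfl⟩

theorem eq_one_of_mul_eq_one {a b : G} (ha : a ∈ B) (hb : b ∈ B) (e : a * b = 1) : a = 1 :=
  (hB.eq_one_of_eq_mul_mul ha hb (one_mem _) (by simpa using e.symm)).1

theorem leftDivides_antisymm {g h : G} (h₁ : LeftDivides B g h) (h₂ : LeftDivides B h g) :
    g = h := by
  rw [leftDivides_iff] at h₁ h₂
  exact inv_mul_eq_one.1 (hB.eq_one_of_mul_eq_one h₁ h₂ (by simp [mul_assoc]))

theorem rightDivides_antisymm {g h : G} (h₁ : RightDivides B g h) (h₂ : RightDivides B h g) :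
    g = h := by
  rw [rightDivides_iff] at h₁ h₂
  exact (mul_inv_eq_one.1 (hB.eq_one_of_mul_eq_one h₁ h₂ (by simp [mul_assoc]))).symm

theorem eq_one_of_leftDivides_one {g : G} (hg : g ∈ B) (h : LeftDivides B g 1) : g = 1 :=
  hB.leftDivides_antisymm h (one_leftDivides hg)

/-- Noetherian induction on proper factors. -/
theorem factor_induction {C : G → Prop}
    (ih : ∀ g ∈ B, (∀ k ∈ B, k ≠ g → (∃ a ∈ B, ∃ b ∈ B, g = a * k * b) → C k) → C g) :
    ∀ g ∈ B, C g := by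
  by_contra! hne
  obtain ⟨g₀, hg₀, hC₀⟩ := hne
  have step : ∀ g : {g // g ∈ B ∧ ¬ C g}, ∃ k : {g // g ∈ B ∧ ¬ C g}, k.1 ≠ g.1 ∧
      ∃ a ∈ B, ∃ b ∈ B, g.1 = a * k.1 * b := by
    rintro ⟨g, hg, hC⟩
    by_contra! hk
    exact hC (ih g hg fun k hkB hne ⟨a, ha, b, hb, e⟩ => by
      by_contra hCk
      exact hk ⟨k, hkB, hCk⟩ hne a ha b hb e)
  choose f hne hf using step
  obtain ⟨n, hn⟩ := hB.noetherian (fun i => (f^[i] ⟨g₀, hg₀, hC₀⟩).1) (fun i => (f^[i] _).2.1)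
    (fun i => by simpa only [Function.iterate_succ_apply'] using hf _)
  have := hn (n + 1) (by omega)
  simp only [Function.iterate_succ_apply'] at this
  exact hne _ this

theorem exists_atom_leftDivides {g : G} (hg : g ∈ B) (h1 : g ≠ 1) :
    ∃ s ∈ atomSet B, LeftDivides B s g := by
  revert h1
  refine hB.factor_induction (C := fun g => g ≠ 1 → ∃ s ∈ atomSet B, LeftDivides B s g)
    (fun g hg ih h1 => ?_) g hg
  by_cases hat : g ∈ atomSet B
  · exact ⟨g, hat, LeftDivides.refl _ _⟩
  · have : ∃ a ∈ B, ∃ b ∈ B, g = a * b ∧ a ≠ 1 ∧ b ≠ 1 := by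
      by_contra! hcon
      refine hat ⟨hg, h1, fun a ha b hb e => ?_⟩
      by_cases h : a = 1
      · exact Or.inl h
      · exact Or.inr (hcon a ha b hb e h)
    obtain ⟨a, ha, b, hb, rfl, ha1, hb1⟩ := this
    clear hg h1
    obtain ⟨s, hs, hd⟩ := ih a ha (by simpa using hb1) ⟨1, one_mem _, b, hb, by simp⟩ ha1
    exact ⟨s, hs, hd.trans (leftDivides_mul_right hb)⟩

/-- Noetherian induction on the quotients by nontrivial left-divisors. -/
theorem quotient_induction {C : G → Prop}
    (ih : ∀ g ∈ B, (∀ a ∈ B, ∀ k ∈ B, a ≠ 1 → LeftDivides B (a * k) g → C k) → C g) :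
    ∀ g ∈ B, C g :=
  hB.factor_induction fun g hg h => ih g hg fun a ha k hk ha1 ⟨b, hb, e⟩ =>
    h k hk (by rintro rfl; exact ha1 (hB.eq_one_of_eq_mul_mul ha hb hk e).1) ⟨a, ha, b, hb, e⟩

theorem atom_induction {C : G → Prop} (one : C 1)
    (mul : ∀ s ∈ atomSet B, ∀ k ∈ B, C k → C (s * k)) : ∀ g ∈ B, C g :=
  hB.quotient_induction fun g hg ih => by
    by_cases h1 : g = 1
    · rwa [h1]
    · obtain ⟨s, hs, k, hk, rfl⟩ := hB.exists_atom_leftDivides hg h1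
      exact mul s hs k hk (ih s hs.1 k hk hs.2.1 (LeftDivides.refl _ _))

end IsGarsideMonoid

/-- A submonoid that contains the factors of its elements. -/
def FactorClosed (B P : Submonoid G) : Prop := ∀ a ∈ B, ∀ b ∈ B, a * b ∈ P → a ∈ P ∧ b ∈ P

theorem FactorClosed.left {B P : Submonoid G} (hP : FactorClosed B P) {a b : G} (ha : a ∈ B)
    (hb : b ∈ P) (hd : LeftDivides B a b) : a ∈ P := by
  obtain ⟨k, hk, rfl⟩ := hd
  exact (hP a ha k hk hb).1

theorem FactorClosed.quotient {B P : Submonoid G} (hP : FactorClosed B P) {a b : G} (ha : a ∈ B)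
    (hb : b ∈ P) (hd : LeftDivides B a b) : a⁻¹ * b ∈ P := by
  obtain ⟨k, hk, rfl⟩ := hd
  simpa using (hP a ha k hk hb).2

theorem FactorClosed.right {B P : Submonoid G} (hP : FactorClosed B P) {a b : G} (ha : a ∈ B)
    (hb : b ∈ P) (hd : RightDivides B a b) : a ∈ P := by
  obtain ⟨k, hk, rfl⟩ := hd
  exact (hP k hk a ha hb).2

theorem FactorClosed.atom {B P : Submonoid G} (hP : FactorClosed B P) (hPB : P ≤ B) {s : G}
    (hs : s ∈ atomSet P) : s ∈ atomSet B :=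
  ⟨hPB hs.1, hs.2.1, fun a ha b hb e =>
    have h := hP a ha b hb (e ▸ hs.1); hs.2.2 a h.1 b h.2 e⟩

theorem FactorClosed.exists_leftDivides_pow {B P : Submonoid G} {Δ δ : G}
    (hB : IsGarsideMonoid B Δ) (hP : FactorClosed B P) (hPB : P ≤ B) (hδ : δ ∈ P)
    (hconj : ConjTo δ P P) (hatom : ∀ s ∈ atomSet B, s ∈ P → LeftDivides B s δ) {g : G}
    (hg : g ∈ P) : ∃ n, ∀ m, n ≤ m → LeftDivides P g (δ ^ m) := by
  have key : ∃ n, LeftDivides P g (δ ^ n) := by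
    refine hB.atom_induction (C := fun g => g ∈ P → ∃ n, LeftDivides P g (δ ^ n))
      (fun _ => ⟨0, by simpa using LeftDivides.refl P 1⟩) ?_ g (hPB hg) hg
    rintro s hs k hk ih hsk
    obtain ⟨hsP, hkP⟩ := hP s hs.1 k hk hsk
    obtain ⟨n, hn⟩ := ih hkP
    refine ⟨n + 1, ((leftDivides_mul_left_iff s).2 hn).trans ?_⟩
    -- With `δ = s * s'`, one has `δ ^ (n + 1) = s * δ ^ n * (δ⁻ⁿ * s' * δ ^ n)`, and the last
    -- factor stays in `P`.
    have h₂ := (hconj.pow n).mem (hP.quotient hs.1 hδ (hatom s hs hsP))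
    rw [leftDivides_iff]
    convert h₂ using 1
    rw [pow_succ']
    simp only [mul_inv_rev, mul_assoc]
  obtain ⟨n, hn⟩ := key
  refine ⟨n, fun m hm => hn.trans ?_⟩
  obtain ⟨k, rfl⟩ := Nat.exists_eq_add_of_le hm
  rw [pow_add]
  exact leftDivides_mul_right (pow_mem hδ k)

namespace IsGarsideMonoid

variable {B : Submonoid G} {Δ : G} (hB : IsGarsideMonoid B Δ)
include hB

theorem exists_leftDivides_pow {g : G} (hg : g ∈ B) :
    ∃ n, ∀ m, n ≤ m → LeftDivides B g (Δ ^ m) :=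
  FactorClosed.exists_leftDivides_pow hB (fun _ ha _ hb _ => ⟨ha, hb⟩) le_rfl hB.delta_mem
    hB.delta_conj (fun s hs _ => hB.atom_dvd s hs) hg

theorem exists_rightDivides_pow {g : G} (hg : g ∈ B) :
    ∃ n, ∀ m, n ≤ m → RightDivides B g (Δ ^ m) := by
  obtain ⟨n, hn⟩ := hB.exists_leftDivides_pow hg
  exact ⟨n, fun m hm => (hB.delta_conj.pow m).leftDivides_iff_rightDivides.1 (hn m hm)⟩

/-- Denominators can be taken to be powers of `Δ`: such a power moves past any element by
conjugation, and every element of `B` divides one. -/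
theorem exists_fraction {g : G} (hg : g ∈ Subgroup.closure (B : Set G)) :
    ∃ a ∈ B, ∃ n : ℕ, g = a * (Δ ^ n)⁻¹ := by
  induction hg using Subgroup.closure_induction with
  | mem x hx => exact ⟨x, hx, 0, by simp⟩
  | one => exact ⟨1, one_mem _, 0, by simp⟩
  | mul x y _ _ hx hy =>
    obtain ⟨a, ha, n, rfl⟩ := hx
    obtain ⟨b, hb, m, rfl⟩ := hy
    refine ⟨a * ((Δ ^ n)⁻¹ * b * Δ ^ n), mul_mem ha ?_, m + n, ?_⟩
    · simpa using (hB.delta_conj.pow n).mem hb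
    · simp [pow_add, mul_assoc]
  | inv x _ hx =>
    obtain ⟨a, ha, n, rfl⟩ := hx
    obtain ⟨m, hm⟩ := hB.exists_leftDivides_pow ha
    obtain ⟨k, hk, e⟩ := hm m le_rfl
    exact ⟨Δ ^ n * k, mul_mem (pow_mem hB.delta_mem n) hk, m, by rw [e]; simp⟩

end IsGarsideMonoid

/-- A submonoid that is stable under quotients and under the lattice operations of a Garside monoid
is a Garside monoid. -/
theorem IsGarsideMonoid.of_sublattice {B P : Submonoid G} {Δ δ : G} (hB : IsGarsideMonoid B Δ)
    (hPB : P ≤ B) (hl : ∀ a ∈ P, ∀ b ∈ P, LeftDivides B a b → LeftDivides P a b)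
    (hr : ∀ a ∈ P, ∀ b ∈ P, RightDivides B a b → RightDivides P a b)
    (left_lcm : ∀ g ∈ P, ∀ h ∈ P, ∀ l, IsLeftLcm B g h l → l ∈ P)
    (left_gcd : ∀ g ∈ P, ∀ h ∈ P, ∀ d, IsLeftGcd B g h d → d ∈ P)
    (right_lcm : ∀ g ∈ P, ∀ h ∈ P, ∀ l, IsRightLcm B g h l → l ∈ P)
    (right_gcd : ∀ g ∈ P, ∀ h ∈ P, ∀ d, IsRightGcd B g h d → d ∈ P)
    (hδ : δ ∈ P) (hconj : ConjTo δ P P) (hatom : ∀ s ∈ atomSet P, LeftDivides B s δ) :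
    IsGarsideMonoid P δ where
  delta_mem := hδ
  delta_conj := hconj
  noetherian w hw h := hB.noetherian w (fun i => hPB (hw i)) fun i =>
    let ⟨a, ha, b, hb, e⟩ := h i; ⟨a, hPB ha, b, hPB hb, e⟩
  left_lcm g hg h hh := by
    obtain ⟨l, hlB⟩ := hB.left_lcm g (hPB hg) h (hPB hh)
    have hlP := left_lcm g hg h hh l hlB
    exact ⟨l, hlP, hl _ hg _ hlP hlB.2.1, hl _ hh _ hlP hlB.2.2.1, fun m hm h₁ h₂ =>
      hl _ hlP _ hm (hlB.2.2.2 m (hPB hm) (h₁.mono hPB) (h₂.mono hPB))⟩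
  left_gcd g hg h hh := by
    obtain ⟨l, hlB⟩ := hB.left_gcd g (hPB hg) h (hPB hh)
    have hlP := left_gcd g hg h hh l hlB
    exact ⟨l, hlP, hl _ hlP _ hg hlB.2.1, hl _ hlP _ hh hlB.2.2.1, fun m hm h₁ h₂ =>
      hl _ hm _ hlP (hlB.2.2.2 m (hPB hm) (h₁.mono hPB) (h₂.mono hPB))⟩
  right_lcm g hg h hh := by
    obtain ⟨l, hlB⟩ := hB.right_lcm g (hPB hg) h (hPB hh)
    have hlP := right_lcm g hg h hh l hlB
    exact ⟨l, hlP, hr _ hg _ hlP hlB.2.1, hr _ hh _ hlP hlB.2.2.1,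
      fun m hm ⟨a, ha, e⟩ ⟨b, hb, e'⟩ =>
        hr _ hlP _ hm (hlB.2.2.2 m (hPB hm) ⟨a, hPB ha, e⟩ ⟨b, hPB hb, e'⟩)⟩
  right_gcd g hg h hh := by
    obtain ⟨l, hlB⟩ := hB.right_gcd g (hPB hg) h (hPB hh)
    have hlP := right_gcd g hg h hh l hlB
    exact ⟨l, hlP, hr _ hlP _ hg hlB.2.1, hr _ hlP _ hh hlB.2.2.1,
      fun m hm ⟨a, ha, e⟩ ⟨b, hb, e'⟩ =>
        hr _ hm _ hlP (hlB.2.2.2 m (hPB hm) ⟨a, hPB ha, e⟩ ⟨b, hPB hb, e'⟩)⟩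
  atom_dvd s hs := hl s hs.1 δ hδ (hatom s hs)

/-! ### Parabolic submonoids -/

namespace IsParabolicWith

variable {B P : Submonoid G} {Δ δ : G}

theorem interval_iff (hP : IsParabolicWith B Δ P δ) {g : G} (hg : g ∈ B) :
    LeftDivides B g δ ↔ LeftDivides B g Δ ∧ g ∈ P := by
  have := Set.ext_iff.1 hP.interval_eq_inter g
  simpa [hg] using this

theorem delta_mem_self (hP : IsParabolicWith B Δ P δ) : δ ∈ P :=
  ((hP.interval_iff hP.delta_mem).1 (LeftDivides.refl _ _)).2

theorem delta_dvd (hP : IsParabolicWith B Δ P δ) : LeftDivides B δ Δ :=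
  ((hP.interval_iff hP.delta_mem).1 (LeftDivides.refl _ _)).1

/-- The element `g` divides the gcd of `Δ` and `p`, and `interval_eq_gcd` places that gcd below `δ`.
-/
theorem dvd_delta_of_dvd_mem (hB : IsGarsideMonoid B Δ) (hP : IsParabolicWith B Δ P δ) {g p : G}
    (hg : g ∈ B) (hp : p ∈ P) (h₁ : LeftDivides B g Δ) (h₂ : LeftDivides B g p) :
    LeftDivides B g δ := by
  obtain ⟨d, hd⟩ := hB.left_gcd Δ hB.delta_mem p (hP.le hp)
  have : d ∈ {g | ∃ p ∈ P, IsLeftGcd B Δ p g} := ⟨p, hp, hd⟩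
  rw [← hP.interval_eq_gcd] at this
  exact (hd.2.2.2 g hg h₁ h₂).trans this.2

/-- The quotients of `δ` by its left-divisors lie in `P`. -/
theorem complement_mem (hP : IsParabolicWith B Δ P δ) {g : G} (hg : g ∈ B)
    (hd : LeftDivides B g δ) : g⁻¹ * δ ∈ P := by
  have hgP := ((hP.interval_iff hg).1 hd).2
  have hk : g⁻¹ * δ ∈ B := leftDivides_iff.1 hd
  refine ((hP.interval_iff hk).1 ?_).2
  rw [leftDivides_iff]
  simpa [mul_assoc] using hP.le (hP.delta_conj.mem hgP)

/-- Let `s` be the first atom of `k = s * k'`. Conjugating by `δ ^ n` brings `s` to the front of an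
element of `P`, so `s` divides `δ`. Then `δ ^ (n + 1) * k'` is a conjugate of `δ * s⁻¹` times `δ ^ n
* k`, so it lies in `P`. The exponent grows while `k` shrinks, hence the quantification over `n`. -/
theorem mem_of_pow_mul_mem (hB : IsGarsideMonoid B Δ) (hP : IsParabolicWith B Δ P δ) {k : G}
    (hk : k ∈ B) : ∀ n : ℕ, δ ^ n * k ∈ P → k ∈ P := by
  refine hB.atom_induction (C := fun k => ∀ n : ℕ, δ ^ n * k ∈ P → k ∈ P)
    (fun _ _ => one_mem _) (fun s hs k hk ih n hn => ?_) k hk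
  have h₁ : s * k * δ ^ n ∈ P := by simpa [mul_assoc] using (hP.delta_conj.pow n).mem hn
  have h₂ : LeftDivides B s δ := hP.dvd_delta_of_dvd_mem hB hs.1 h₁ (hB.atom_dvd s hs)
    ⟨k * δ ^ n, mul_mem hk (pow_mem hP.delta_mem n), by simp [mul_assoc]⟩
  have hsP := ((hP.interval_iff hs.1).1 h₂).2
  have h₃ : δ * s⁻¹ ∈ P := by simpa [mul_assoc] using hP.delta_conj.mem' (hP.complement_mem hs.1 h₂)
  refine mul_mem hsP (ih (n + 1) ?_)
  have h₄ : δ ^ n * (δ * s⁻¹) * (δ ^ n)⁻¹ ∈ P := by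
    simpa using (hP.delta_conj.pow n).mem' h₃
  simpa [pow_succ, mul_assoc] using mul_mem h₄ hn

/-- The first atom `s` of `a` divides `δ`, hence lies in `P` together with `δ * s⁻¹`. Multiplying by
the latter replaces `s` by `δ`, which `mem_of_pow_mul_mem` removes. -/
theorem factorClosed (hB : IsGarsideMonoid B Δ) (hP : IsParabolicWith B Δ P δ) :
    FactorClosed B P := by
  intro a ha b hb
  refine hB.atom_induction (C := fun a => a * b ∈ P → a ∈ P ∧ b ∈ P)
    (fun h => ⟨one_mem _, by simpa using h⟩) (fun s hs k hk ih h => ?_) a ha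
  rw [mul_assoc] at h
  have h₂ : LeftDivides B s δ := hP.dvd_delta_of_dvd_mem hB hs.1 h (hB.atom_dvd s hs)
    ⟨k * b, mul_mem hk hb, rfl⟩
  have hsP := ((hP.interval_iff hs.1).1 h₂).2
  have h₃ : δ * s⁻¹ ∈ P := by simpa [mul_assoc] using hP.delta_conj.mem' (hP.complement_mem hs.1 h₂)
  have h₄ := hP.mem_of_pow_mul_mem hB (mul_mem hk hb) 1
    (by simpa [mul_assoc] using mul_mem h₃ h)
  exact ⟨mul_mem hsP (ih h₄).1, (ih h₄).2⟩

end IsParabolicWith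

theorem FactorClosed.le_closure {B P : Submonoid G} {Δ : G} (hB : IsGarsideMonoid B Δ)
    (hP : FactorClosed B P) (hPB : P ≤ B) {T : Set G} (hT : ∀ s ∈ atomSet B, s ∈ P → s ∈ T) :
    P ≤ Submonoid.closure T := by
  intro g hg
  refine hB.atom_induction (C := fun g => g ∈ P → g ∈ Submonoid.closure T)
    (fun _ => one_mem _) (fun s hs k hk ih h => ?_) g (hPB hg) hg
  have := hP s hs.1 k hk h
  exact mul_mem (Submonoid.subset_closure (hT s hs this.1)) (ih this.2)

/-- A submonoid `P` that contains the factors of its elements and is normalized by `δ` is parabolic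
as soon as `[1, δ] = [1, Δ] ∩ P`. -/
theorem IsParabolicWith.of_factorClosed {B P : Submonoid G} {Δ δ : G} (hB : IsGarsideMonoid B Δ)
    (hPB : P ≤ B) (hP : FactorClosed B P) (hδ : δ ∈ B) (hconj : ConjTo δ P P)
    (hint : ∀ g ∈ B, (LeftDivides B g δ ↔ LeftDivides B g Δ ∧ g ∈ P)) :
    IsParabolicWith B Δ P δ := by
  have hδP : δ ∈ P := ((hint δ hδ).1 (LeftDivides.refl _ _)).2
  have hpow : ∀ g ∈ P, ∃ n, ∀ m, n ≤ m → LeftDivides P g (δ ^ m) := fun g hg =>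
    hP.exists_leftDivides_pow hB hPB hδP hconj
      (fun s hs hsP => (hint s hs.1).2 ⟨hB.atom_dvd s hs, hsP⟩) hg
  exact
  { le := hPB
    left_lcm_mem := fun g hg h hh l hl => by
      obtain ⟨n, hn⟩ := hpow g hg
      obtain ⟨m, hm⟩ := hpow h hh
      -- A large power of `δ` is a common multiple lying in `P`; the lcm divides it, and factors
      -- stay in `P`.
      exact hP.left hl.1 (pow_mem hδP (max n m)) (hl.2.2.2 _ (pow_mem hδ _)
        ((hn _ (le_max_left _ _)).mono hPB) ((hm _ (le_max_right _ _)).mono hPB))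
    left_gcd_mem := fun g hg h hh d hd => hP.left hd.1 hg hd.2.1
    right_lcm_mem := fun g hg h hh l hl => by
      obtain ⟨n, hn⟩ := hpow g hg
      obtain ⟨m, hm⟩ := hpow h hh
      obtain ⟨a, ha, e⟩ := (hconj.pow _).leftDivides_iff_rightDivides.1 (hn _ (le_max_left n m))
      obtain ⟨b, hb, e'⟩ := (hconj.pow _).leftDivides_iff_rightDivides.1 (hm _ (le_max_right n m))
      exact hP.right hl.1 (pow_mem hδP (max n m)) (hl.2.2.2 _ (pow_mem hδ _)
        ⟨a, hPB ha, e⟩ ⟨b, hPB hb, e'⟩)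
    right_gcd_mem := fun g hg h hh d hd => hP.right hd.1 hg hd.2.1
    delta_mem := hδ
    delta_conj := hconj
    interval_eq_inter := by
      ext g
      simp only [Set.mem_ofPred_eq, Set.mem_inter_iff, SetLike.mem_coe, and_assoc]
      exact and_congr_right fun hg => hint g hg
    interval_eq_gcd := by
      ext g
      constructor
      · rintro ⟨hg, hd⟩
        obtain ⟨h₁, h₂⟩ := (hint g hg).1 hd
        exact ⟨g, h₂, hg, h₁, LeftDivides.refl _ _, fun m _ _ h => h⟩
      · rintro ⟨p, hp, hd⟩
        exact ⟨hd.1, (hint g hd.1).2 ⟨hd.2.1, hP.left hd.1 hp hd.2.2.1⟩⟩ }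

namespace IsParabolicWith

variable {B P : Submonoid G} {Δ δ : G}

/-- A parabolic submonoid is a Garside monoid. -/
theorem isGarsideMonoid (hB : IsGarsideMonoid B Δ) (hP : IsParabolicWith B Δ P δ) :
    IsGarsideMonoid P δ := by
  have hF := hP.factorClosed hB
  exact hB.of_sublattice hP.le
    (fun a ha b hb hd => leftDivides_iff.2 (hF.quotient (hP.le ha) hb hd))
    (fun a ha b hb ⟨k, hk, e⟩ => ⟨k, (hF k hk a (hP.le ha) (e ▸ hb)).1, e⟩)
    hP.left_lcm_mem hP.left_gcd_mem hP.right_lcm_mem hP.right_gcd_mem hP.delta_mem_self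
    hP.delta_conj fun s hs =>
      (hP.interval_iff (hP.le hs.1)).2 ⟨hB.atom_dvd s (hF.atom hP.le hs), hs.1⟩

theorem self (hB : IsGarsideMonoid B Δ) : IsParabolicWith B Δ B Δ :=
  of_factorClosed hB le_rfl (fun _ ha _ hb _ => ⟨ha, hb⟩) hB.delta_mem hB.delta_conj
    fun g hg => by simp [hg]

/-- Conjugating a parabolic submonoid that lies in a parabolic submonoid `Q`, by an element that
normalizes `Q` and commutes with its Garside element. -/
theorem conj (hB : IsGarsideMonoid B Δ) {Q : Submonoid G} {ε c : G}
    (hP : IsParabolicWith B Δ P δ) (hQ : IsParabolicWith B Δ Q ε) (hPQ : P ≤ Q)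
    (hc : ConjTo c Q Q) (hcε : c * ε = ε * c) :
    IsParabolicWith B Δ (conjSubmonoid c P) (c⁻¹ * δ * c) := by
  have hle : conjSubmonoid c P ≤ Q := fun x hx => by
    simpa [mul_assoc] using hc.mem (hPQ (mem_conjSubmonoid.1 hx))
  have hδ : c⁻¹ * δ * c ∈ Q := hc.mem (hPQ hP.delta_mem_self)
  have hconj : ConjTo c P (conjSubmonoid c P) := conjTo_conjSubmonoid c P
  have hε : c⁻¹ * ε * c = ε := by rw [mul_assoc, ← hcε]; simp
  have hε' : c * ε * c⁻¹ = ε := by rw [hcε]; simp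
  refine of_factorClosed hB (hle.trans hQ.le) ?_ (hQ.le hδ) ?_ fun g hg => ?_
  · intro a ha b hb hab
    obtain ⟨haQ, hbQ⟩ := hQ.factorClosed hB a ha b hb (hle hab)
    refine hP.factorClosed hB _ (hQ.le (hc.mem' haQ)) _ (hQ.le (hc.mem' hbQ)) ?_
    simpa [mem_conjSubmonoid, mul_assoc] using hab
  · simpa [mul_assoc] using hconj.inv.mul (hP.delta_conj.mul hconj)
  -- Inside `Q`, dividing `Δ` means dividing `ε`. Conjugation by `c` is an automorphism of `Q`
  -- fixing `ε`, so it carries the interval condition for `δ` to its conjugate.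
  · have hQF := hQ.factorClosed hB
    have hδε : LeftDivides B δ ε :=
      (hQ.interval_iff hP.delta_mem).2 ⟨hP.delta_dvd, hPQ hP.delta_mem_self⟩
    have hδε' := hc.mem (hQF.quotient hP.delta_mem hQ.delta_mem_self hδε)
    constructor
    · intro hd
      have hgQ := hQF.left hg hδ hd
      have h₁ := hc.mem' (hQF.quotient hg hδ hd)
      have h₂ : LeftDivides B (c * g * c⁻¹) δ := by
        rw [leftDivides_iff]; simpa [mul_assoc] using hQ.le h₁
      refine ⟨LeftDivides.trans (hd.trans ?_) hQ.delta_dvd,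
        ((hP.interval_iff (hQ.le (hc.mem' hgQ))).1 h₂).2⟩
      rw [leftDivides_iff, ← hε]
      simpa [mul_assoc] using hQ.le hδε'
    · rintro ⟨h₁, h₂⟩
      have hgQ := hle h₂
      have h₃ := hc.mem' (hQF.quotient hg hQ.delta_mem_self ((hQ.interval_iff hg).2 ⟨h₁, hgQ⟩))
      have h₄ : LeftDivides B (c * g * c⁻¹) ε := by
        rw [leftDivides_iff, ← hε']; simpa [mul_assoc] using hQ.le h₃
      have h₅ := (hP.interval_iff (hQ.le (hc.mem' hgQ))).2 ⟨h₄.trans hQ.delta_dvd, h₂⟩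
      have h₆ := hc.mem (hPQ ((hP.factorClosed hB).quotient (hQ.le (hc.mem' hgQ))
        hP.delta_mem_self h₅))
      rw [leftDivides_iff]
      simpa [mul_assoc] using hQ.le h₆

end IsParabolicWith

end Monoidal

/-! ### Positive ribbons as elements of the ambient group. -/

namespace PosRibbon

variable {G : Type u} [Group G] {B : Submonoid G} {Δ : G}

/-- The morphism of the positive ribbon category defined by an element of `B`. -/
def mk' {P Q : PosRibbon B Δ} (g : G) (hg : g ∈ B) (h : ConjTo g P.carrier Q.carrier) : P ⟶ Q :=
  Hom.mk g hg h

@[simp] theorem elt_mk' {P Q : PosRibbon B Δ} (g : G) (hg : g ∈ B)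
    (h : ConjTo g P.carrier Q.carrier) : elt (mk' g hg h) = g := rfl

@[simp] theorem elt_comp {P Q R : PosRibbon B Δ} (f : P ⟶ Q) (g : Q ⟶ R) :
    elt (f ≫ g) = elt f * elt g := rfl

@[simp] theorem elt_id (P : PosRibbon B Δ) : elt (𝟙 P) = 1 := rfl

theorem elt_mem {P Q : PosRibbon B Δ} (f : P ⟶ Q) : elt f ∈ B := Hom.mem f

theorem elt_conj {P Q : PosRibbon B Δ} (f : P ⟶ Q) : ConjTo (elt f) P.carrier Q.carrier :=
  Hom.conj f

theorem elt_injective {P Q : PosRibbon B Δ} {f g : P ⟶ Q} (h : elt f = elt g) : f = g :=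
  Hom.ext h

@[simp] theorem elt_eqToHom {P Q : PosRibbon B Δ} (h : P = Q) : elt (eqToHom h) = 1 := by
  subst h; rfl

theorem eq_of_conjTo_one {P Q : PosRibbon B Δ} (h : ConjTo 1 P.carrier Q.carrier) : P = Q :=
  PosRibbon.ext h.eq_of_one

theorem isIdentity_iff {P Q : PosRibbon B Δ} (f : P ⟶ Q) : IsIdentity f ↔ elt f = 1 := by
  constructor
  · rintro ⟨h, rfl⟩; simp
  · intro h
    exact ⟨eq_of_conjTo_one (h ▸ elt_conj f), elt_injective (by simpa using h)⟩

/-- A quotient of two ribbons with the same source is automatically a ribbon, so divisibility in the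
category loses nothing against divisibility in `B`. -/
theorem catLeftDivides_iff {P Q R : PosRibbon B Δ} (f : P ⟶ Q) (g : P ⟶ R) :
    CatLeftDivides f g ↔ LeftDivides B (elt f) (elt g) := by
  constructor
  · rintro ⟨k, rfl⟩; exact ⟨elt k, elt_mem k, rfl⟩
  · intro h
    exact ⟨mk' _ (leftDivides_iff.1 h) ((elt_conj f).inv_mul (elt_conj g)),
      elt_injective (by simp)⟩

theorem catRightDivides_iff {P Q R : PosRibbon B Δ} (f : Q ⟶ P) (g : R ⟶ P) :
    CatRightDivides f g ↔ RightDivides B (elt f) (elt g) := by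
  constructor
  · rintro ⟨k, rfl⟩; exact ⟨elt k, elt_mem k, rfl⟩
  · intro h
    exact ⟨mk' _ (rightDivides_iff.1 h) ((elt_conj g).mul_inv (elt_conj f)),
      elt_injective (by simp)⟩

/-- `g` is a positive ribbon with source `P`. -/
def IsFrom (P : PosRibbon B Δ) (g : G) : Prop :=
  g ∈ B ∧ ∃ Q : PosRibbon B Δ, ConjTo g P.carrier Q.carrier

/-- `g` is a positive ribbon with target `P`. -/
def IsTo (P : PosRibbon B Δ) (g : G) : Prop :=
  g ∈ B ∧ ∃ Q : PosRibbon B Δ, ConjTo g Q.carrier P.carrier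

theorem isFrom_elt {P Q : PosRibbon B Δ} (f : P ⟶ Q) : P.IsFrom (elt f) :=
  ⟨elt_mem f, Q, elt_conj f⟩

theorem isTo_elt {P Q : PosRibbon B Δ} (f : P ⟶ Q) : Q.IsTo (elt f) :=
  ⟨elt_mem f, P, elt_conj f⟩

theorem isFrom_one (P : PosRibbon B Δ) : P.IsFrom 1 := ⟨one_mem _, P, ConjTo.one _⟩

theorem IsFrom.mul {P Q : PosRibbon B Δ} (f : P ⟶ Q) {g : G} (hg : Q.IsFrom g) :
    P.IsFrom (elt f * g) :=
  let ⟨hgB, R, hR⟩ := hg; ⟨mul_mem (elt_mem f) hgB, R, (elt_conj f).mul hR⟩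

theorem IsFrom.inv_mul {P Q : PosRibbon B Δ} (f : P ⟶ Q) {g : G} (hg : P.IsFrom g)
    (hd : LeftDivides B (elt f) g) : Q.IsFrom ((elt f)⁻¹ * g) :=
  let ⟨_, R, hR⟩ := hg; ⟨leftDivides_iff.1 hd, R, (elt_conj f).inv_mul hR⟩

end PosRibbon

/-! ### Stability of ribbons under left gcds and lcms. -/

namespace NuFunction

open PosRibbon

variable {G : Type u} [Group G] {B : Submonoid G} {Δ : G}

theorem exists_hom (N : NuFunction B Δ) (P : PosRibbon B Δ) {s : G} (hs : s ∈ atomSet B) :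
    ∃ (Q : PosRibbon B Δ) (f : P ⟶ Q), elt f = N.nu P s ∧ elt f ≠ 1 := by
  obtain ⟨Q, f, e, hf⟩ := N.atom P s hs
  exact ⟨Q, f, e, fun h => hf.1 ((isIdentity_iff f).2 h)⟩

theorem nu_leftDivides (N : NuFunction B Δ) {P : PosRibbon B Δ} {s g : G} (hs : s ∈ atomSet B)
    (hg : P.IsFrom g) (hd : LeftDivides B s g) : LeftDivides B (N.nu P s) g := by
  obtain ⟨hgB, Q, hQ⟩ := hg
  exact N.dvd P s hs Q (mk' g hgB hQ) hd

/-- A nontrivial positive ribbon is left-divisible by some `ν_P(s)`. -/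
theorem exists_nu_leftDivides (hB : IsGarsideMonoid B Δ) (N : NuFunction B Δ) {P : PosRibbon B Δ}
    {g : G} (hg : P.IsFrom g) (h1 : g ≠ 1) :
    ∃ s ∈ atomSet B, LeftDivides B s g ∧
      ∃ (Q : PosRibbon B Δ) (f : P ⟶ Q), elt f = N.nu P s ∧ elt f ≠ 1 ∧
        LeftDivides B (elt f) g := by
  obtain ⟨s, hs, hd⟩ := hB.exists_atom_leftDivides hg.1 h1
  obtain ⟨Q, f, e, hf⟩ := N.exists_hom P hs
  exact ⟨s, hs, hd, Q, f, e, hf, e ▸ N.nu_leftDivides hs hg hd⟩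

/-- An atom `s` below `d` lies below `f` and `g`, so `ν_P(s)` divides both, hence divides `d`.
Cancelling it leaves a gcd of ribbons from the next object, to which induction applies. -/
theorem isFrom_leftGcd (hB : IsGarsideMonoid B Δ) (N : NuFunction B Δ) {d : G} (hd : d ∈ B) :
    ∀ (P : PosRibbon B Δ) (f g : G), P.IsFrom f → P.IsFrom g → IsLeftGcd B f g d → P.IsFrom d := by
  refine hB.quotient_induction (C := fun d => ∀ (P : PosRibbon B Δ) (f g : G),
    P.IsFrom f → P.IsFrom g → IsLeftGcd B f g d → P.IsFrom d) (fun d hd ih P f g hf hg hgcd => ?_)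
    d hd
  by_cases h1 : d = 1
  · rw [h1]; exact P.isFrom_one
  obtain ⟨s, hs, hsd⟩ := hB.exists_atom_leftDivides hd h1
  obtain ⟨Q, v, e, hv⟩ := N.exists_hom P hs
  have hvf : LeftDivides B (elt v) f := e ▸ N.nu_leftDivides hs hf (hsd.trans hgcd.2.1)
  have hvg : LeftDivides B (elt v) g := e ▸ N.nu_leftDivides hs hg (hsd.trans hgcd.2.2.1)
  have hq := hgcd.inv_mul (elt_mem v) hvf hvg
  have := ih (elt v) (elt_mem v) _ hq.1 hv (by simpa using LeftDivides.refl B d) Q _ _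
    (hf.inv_mul v hvf) (hg.inv_mul v hvg) hq
  simpa using this.mul v

theorem isFrom_leftLcm (hB : IsGarsideMonoid B Δ) (N : NuFunction B Δ) {l : G} (hl : l ∈ B) :
    ∀ (P : PosRibbon B Δ) (f g : G), P.IsFrom f → P.IsFrom g → IsLeftLcm B f g l → P.IsFrom l := by
  refine hB.quotient_induction (C := fun l => ∀ (P : PosRibbon B Δ) (f g : G),
    P.IsFrom f → P.IsFrom g → IsLeftLcm B f g l → P.IsFrom l) (fun l hl ih => ?_) l hl
  -- two multiples of a nontrivial ribbon whose lcm divides `l`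
  have step : ∀ (P Q : PosRibbon B Δ) (v : P ⟶ Q) (f g m : G), elt v ≠ 1 → P.IsFrom f →
      P.IsFrom g → LeftDivides B (elt v) f → LeftDivides B (elt v) g → IsLeftLcm B f g m →
      LeftDivides B m l → P.IsFrom m := by
    intro P Q v f g m hv hf hg hvf hvg hm hml
    have hq := hm.inv_mul (elt_mem v) hvf
    have := ih (elt v) (elt_mem v) _ hq.1 hv (by simpa using hml) Q _ _ (hf.inv_mul v hvf)
      (hg.inv_mul v hvg) hq
    simpa using this.mul v
  intro P f g hf hg hlcm
  by_cases hf1 : f = 1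
  · subst hf1
    rwa [hB.leftDivides_antisymm (hlcm.2.2.2 g hg.1 (one_leftDivides hg.1) (LeftDivides.refl _ _))
      hlcm.2.2.1]
  by_cases hg1 : g = 1
  · subst hg1
    rwa [hB.leftDivides_antisymm (hlcm.2.2.2 f hf.1 (LeftDivides.refl _ _) (one_leftDivides hf.1))
      hlcm.2.1]
  obtain ⟨s, hs, -, Q, v, ev, hv, hvf⟩ := N.exists_nu_leftDivides hB hf hf1
  obtain ⟨t, ht, -, R, w, ew, hw, hwg⟩ := N.exists_nu_leftDivides hB hg hg1
  obtain ⟨m, hm⟩ := hB.left_lcm _ (elt_mem v) _ (elt_mem w)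
  have hmF : P.IsFrom m := by
    obtain ⟨T, k, rfl⟩ := N.lcm P s hs t ht m (ev ▸ ew ▸ hm)
    exact isFrom_elt k
  have hml : LeftDivides B m l := hm.2.2.2 l hl (hvf.trans hlcm.2.1) (hwg.trans hlcm.2.2.1)
  -- The lcm is assembled from pairs with a common nontrivial ribbon factor, to which `step`
  -- applies: `f` and `m` share `v`, `m` and `g` share `w`, and the resulting `a` and `b` share `v`,
  -- since `v` divides `m`. Their lcm is `l`.
  obtain ⟨a, ha⟩ := hB.left_lcm f hf.1 m hm.1
  obtain ⟨b, hb⟩ := hB.left_lcm m hm.1 g hg.1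
  have hal := ha.2.2.2 l hl hlcm.2.1 hml
  have hbl := hb.2.2.2 l hl hml hlcm.2.2.1
  have haF := step P Q v f m a hv hf hmF hvf hm.2.1 ha hal
  have hbF := step P R w m g b hw hmF hg hm.2.2.1 hwg hb hbl
  refine step P Q v a b l hv haF hbF (hvf.trans ha.2.1) (hm.2.1.trans hb.2.1)
    ⟨hl, hal, hbl, fun n hn h₁ h₂ => ?_⟩ (LeftDivides.refl _ _)
  exact hlcm.2.2.2 n hn (ha.2.1.trans h₁) (hb.2.2.1.trans h₂)

end NuFunction

/-! ### Duality between left and right lattice operations -/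

section Duality

variable {G : Type u} [Group G] {B : Submonoid G} {D : G}

/-- On right-divisors of `D`, the map `x ↦ D * x⁻¹` turns right-divisibility into reversed
left-divisibility. A competitor `m` for the gcd divides `D`, so it is itself of this form, with `x =
m⁻¹ * D`. -/
theorem IsRightLcm.isLeftGcd_dual {f g l : G} (hf : f ∈ B) (hl : IsRightLcm B f g l)
    (hfD : RightDivides B f D) (hgD : RightDivides B g D) (hD : D ∈ B) :
    IsLeftGcd B (D * f⁻¹) (D * g⁻¹) (D * l⁻¹) := by
  obtain ⟨-, h₁, h₂, h₃⟩ := hl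
  have hlD := h₃ D hD hfD hgD
  simp only [rightDivides_iff] at *
  refine ⟨hlD, ?_, ?_, fun m hm hm₁ hm₂ => ?_⟩
  · rw [leftDivides_iff]; simpa [mul_assoc] using h₁
  · rw [leftDivides_iff]; simpa [mul_assoc] using h₂
  · rw [leftDivides_iff] at *
    have hmD : m⁻¹ * D ∈ B := by simpa [mul_assoc] using mul_mem hm₁ hf
    simpa [mul_assoc] using h₃ (m⁻¹ * D) hmD (by simpa [mul_assoc] using hm₁)
      (by simpa [mul_assoc] using hm₂)

theorem IsRightGcd.isLeftLcm_dual {Δ f g d : G} (hB : IsGarsideMonoid B Δ) (hf : f ∈ B)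
    (hg : g ∈ B) (hd : IsRightGcd B f g d) (hfD : RightDivides B f D) (hgD : RightDivides B g D)
    (hD : D ∈ B) : IsLeftLcm B (D * f⁻¹) (D * g⁻¹) (D * d⁻¹) := by
  obtain ⟨-, h₁, h₂, h₃⟩ := hd
  simp only [rightDivides_iff] at *
  refine ⟨by simpa [mul_assoc] using mul_mem hfD h₁, ?_, ?_, fun m hm hm₁ hm₂ => ?_⟩
  · rw [leftDivides_iff]; simpa [mul_assoc] using h₁
  · rw [leftDivides_iff]; simpa [mul_assoc] using h₂
  -- A common multiple `m` need not divide `D`; its gcd with `D` is still a common multiple, and it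
  -- lies in the range of the duality.
  · obtain ⟨e, -, hem, heD, he⟩ := hB.left_gcd m hm D hD
    have hf' := he _ hfD hm₁ (leftDivides_iff.2 (by simpa [mul_assoc] using hf))
    have hg' := he _ hgD hm₂ (leftDivides_iff.2 (by simpa [mul_assoc] using hg))
    rw [leftDivides_iff] at *
    have := h₃ (e⁻¹ * D) heD (by simpa [mul_assoc] using hf') (by simpa [mul_assoc] using hg')
    simpa [mul_assoc] using mul_mem this hem

end Duality

namespace PosRibbon

variable {G : Type u} [Group G] {B : Submonoid G} {Δ : G}

/-- The object `c⁻¹ P c`, for `c` normalizing `B` and commuting with `Δ`. -/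
def conj (hB : IsGarsideMonoid B Δ) {c : G} (hc : ConjTo c B B) (hcΔ : c * Δ = Δ * c)
    (P : PosRibbon B Δ) : PosRibbon B Δ :=
  ⟨conjSubmonoid c P.carrier, let ⟨_, hδ⟩ := P.isParabolic
    ⟨_, hδ.conj hB (IsParabolicWith.self hB) hδ.le hc hcΔ⟩⟩

theorem conjTo_conj (hB : IsGarsideMonoid B Δ) {c : G} (hc : ConjTo c B B) (hcΔ : c * Δ = Δ * c)
    (P : PosRibbon B Δ) : ConjTo c P.carrier (P.conj hB hc hcΔ).carrier :=
  conjTo_conjSubmonoid c _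

/-- Supplies the object at which a power of `Δ` must start in order to be a ribbon ending at `P`, so
that complements of ribbons to `P` are ribbons with a common source. -/
theorem exists_conjTo_pow (hB : IsGarsideMonoid B Δ) (P : PosRibbon B Δ) (n : ℕ) :
    ∃ Q : PosRibbon B Δ, ConjTo (Δ ^ n) Q.carrier P.carrier :=
  ⟨P.conj hB (hB.delta_conj.pow n).inv ((Commute.refl Δ).pow_left n).inv_left.eq, by
    simpa using (conjTo_conj hB (hB.delta_conj.pow n).inv
      ((Commute.refl Δ).pow_left n).inv_left.eq P).inv⟩

theorem isTo_of_isFrom_dual {P Q : PosRibbon B Δ} {D l : G} (hQ : ConjTo D Q.carrier P.carrier)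
    (hl : l ∈ B) (h : Q.IsFrom (D * l⁻¹)) : P.IsTo l := by
  obtain ⟨-, R, hR⟩ := h
  exact ⟨hl, R, by simpa using hR.inv_mul hQ⟩

theorem isFrom_dual_of_isTo {P Q : PosRibbon B Δ} {D l : G} (hQ : ConjTo D Q.carrier P.carrier)
    (hl : RightDivides B l D) (h : P.IsTo l) : Q.IsFrom (D * l⁻¹) := by
  obtain ⟨-, R, hR⟩ := h
  exact ⟨rightDivides_iff.1 hl, R, hQ.mul_inv hR⟩

/-- Two elements of a Garside monoid right-divide a common power of `Δ`. -/
theorem _root_.IsGarsideMonoid.exists_rightDivides_pow₂ (hB : IsGarsideMonoid B Δ) {f g : G}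
    (hf : f ∈ B) (hg : g ∈ B) : ∃ n, RightDivides B f (Δ ^ n) ∧ RightDivides B g (Δ ^ n) := by
  obtain ⟨n, hn⟩ := hB.exists_rightDivides_pow hf
  obtain ⟨m, hm⟩ := hB.exists_rightDivides_pow hg
  exact ⟨max n m, hn _ (le_max_left _ _), hm _ (le_max_right _ _)⟩

theorem isTo_rightLcm (hB : IsGarsideMonoid B Δ) (N : NuFunction B Δ) {P : PosRibbon B Δ}
    {f g l : G} (hf : P.IsTo f) (hg : P.IsTo g) (hl : IsRightLcm B f g l) : P.IsTo l := by
  obtain ⟨n, hfD, hgD⟩ := hB.exists_rightDivides_pow₂ hf.1 hg.1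
  obtain ⟨Q, hQ⟩ := P.exists_conjTo_pow hB n
  have hd := hl.isLeftGcd_dual hf.1 hfD hgD (pow_mem hB.delta_mem n)
  exact isTo_of_isFrom_dual hQ hl.1 (N.isFrom_leftGcd hB hd.1 Q _ _
    (isFrom_dual_of_isTo hQ hfD hf) (isFrom_dual_of_isTo hQ hgD hg) hd)

theorem isTo_rightGcd (hB : IsGarsideMonoid B Δ) (N : NuFunction B Δ) {P : PosRibbon B Δ}
    {f g d : G} (hf : P.IsTo f) (hg : P.IsTo g) (hd : IsRightGcd B f g d) : P.IsTo d := by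
  obtain ⟨n, hfD, hgD⟩ := hB.exists_rightDivides_pow₂ hf.1 hg.1
  obtain ⟨Q, hQ⟩ := P.exists_conjTo_pow hB n
  have hl := hd.isLeftLcm_dual hB hf.1 hg.1 hfD hgD (pow_mem hB.delta_mem n)
  exact isTo_of_isFrom_dual hQ hd.1 (N.isFrom_leftLcm hB hl.1 Q _ _
    (isFrom_dual_of_isTo hQ hfD hf) (isFrom_dual_of_isTo hQ hgD hg) hl)

/-! ### Lattice operations in the positive ribbon category -/

section Lattice

variable (hB : IsGarsideMonoid B Δ) (N : NuFunction B Δ)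
include hB N

theorem exists_isLeftLcm {P Q R : PosRibbon B Δ} (f : P ⟶ Q) (g : P ⟶ R) :
    ∃ (W : PosRibbon B Δ) (l : P ⟶ W), IsLeftLcm B (elt f) (elt g) (elt l) := by
  obtain ⟨l, hl⟩ := hB.left_lcm _ (elt_mem f) _ (elt_mem g)
  obtain ⟨h, W, hW⟩ := N.isFrom_leftLcm hB hl.1 P _ _ (isFrom_elt f) (isFrom_elt g) hl
  exact ⟨W, mk' l h hW, hl⟩

theorem exists_isLeftGcd {P Q R : PosRibbon B Δ} (f : P ⟶ Q) (g : P ⟶ R) :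
    ∃ (W : PosRibbon B Δ) (d : P ⟶ W), IsLeftGcd B (elt f) (elt g) (elt d) := by
  obtain ⟨d, hd⟩ := hB.left_gcd _ (elt_mem f) _ (elt_mem g)
  obtain ⟨h, W, hW⟩ := N.isFrom_leftGcd hB hd.1 P _ _ (isFrom_elt f) (isFrom_elt g) hd
  exact ⟨W, mk' d h hW, hd⟩

theorem exists_isRightLcm {P Q R : PosRibbon B Δ} (f : Q ⟶ P) (g : R ⟶ P) :
    ∃ (W : PosRibbon B Δ) (l : W ⟶ P), IsRightLcm B (elt f) (elt g) (elt l) := by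
  obtain ⟨l, hl⟩ := hB.right_lcm _ (elt_mem f) _ (elt_mem g)
  obtain ⟨h, W, hW⟩ := isTo_rightLcm hB N (isTo_elt f) (isTo_elt g) hl
  exact ⟨W, mk' l h hW, hl⟩

theorem exists_isRightGcd {P Q R : PosRibbon B Δ} (f : Q ⟶ P) (g : R ⟶ P) :
    ∃ (W : PosRibbon B Δ) (d : W ⟶ P), IsRightGcd B (elt f) (elt g) (elt d) := by
  obtain ⟨d, hd⟩ := hB.right_gcd _ (elt_mem f) _ (elt_mem g)
  obtain ⟨h, W, hW⟩ := isTo_rightGcd hB N (isTo_elt f) (isTo_elt g) hd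
  exact ⟨W, mk' d h hW, hd⟩

omit hB N in
theorem isCatLeftLcm_of {P Q R W : PosRibbon B Δ} {f : P ⟶ Q} {g : P ⟶ R} {l : P ⟶ W}
    (h : IsLeftLcm B (elt f) (elt g) (elt l)) : IsCatLeftLcm f g l := by
  simp only [IsCatLeftLcm, catLeftDivides_iff]
  exact ⟨h.2.1, h.2.2.1, fun T m => h.2.2.2 _ (elt_mem m)⟩

omit hB N in
theorem isCatLeftGcd_of {P Q R W : PosRibbon B Δ} {f : P ⟶ Q} {g : P ⟶ R} {l : P ⟶ W}
    (h : IsLeftGcd B (elt f) (elt g) (elt l)) : IsCatLeftGcd f g l := by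
  simp only [IsCatLeftGcd, catLeftDivides_iff]
  exact ⟨h.2.1, h.2.2.1, fun T m => h.2.2.2 _ (elt_mem m)⟩

omit hB N in
theorem isCatRightLcm_of {P Q R W : PosRibbon B Δ} {f : Q ⟶ P} {g : R ⟶ P} {l : W ⟶ P}
    (h : IsRightLcm B (elt f) (elt g) (elt l)) : IsCatRightLcm f g l := by
  simp only [IsCatRightLcm, catRightDivides_iff]
  exact ⟨h.2.1, h.2.2.1, fun T m => h.2.2.2 _ (elt_mem m)⟩

omit hB N in
theorem isCatRightGcd_of {P Q R W : PosRibbon B Δ} {f : Q ⟶ P} {g : R ⟶ P} {l : W ⟶ P}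
    (h : IsRightGcd B (elt f) (elt g) (elt l)) : IsCatRightGcd f g l := by
  simp only [IsCatRightGcd, catRightDivides_iff]
  exact ⟨h.2.1, h.2.2.1, fun T m => h.2.2.2 _ (elt_mem m)⟩

/-- The categorical notion only tests ribbons, but the lcm in `B` is itself a ribbon, so
antisymmetry identifies the two. The other three cases are alike. -/
theorem isCatLeftLcm_iff {P Q R W : PosRibbon B Δ} {f : P ⟶ Q} {g : P ⟶ R} {l : P ⟶ W} :
    IsCatLeftLcm f g l ↔ IsLeftLcm B (elt f) (elt g) (elt l) := by
  refine ⟨fun h => ?_, isCatLeftLcm_of⟩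
  obtain ⟨W', l', hl'⟩ := exists_isLeftLcm hB N f g
  have h' := isCatLeftLcm_of hl'
  rwa [hB.leftDivides_antisymm ((catLeftDivides_iff _ _).1 (h.2.2 _ _ h'.1 h'.2.1))
    ((catLeftDivides_iff _ _).1 (h'.2.2 _ _ h.1 h.2.1))]

theorem isCatLeftGcd_iff {P Q R W : PosRibbon B Δ} {f : P ⟶ Q} {g : P ⟶ R} {l : P ⟶ W} :
    IsCatLeftGcd f g l ↔ IsLeftGcd B (elt f) (elt g) (elt l) := by
  refine ⟨fun h => ?_, isCatLeftGcd_of⟩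
  obtain ⟨W', l', hl'⟩ := exists_isLeftGcd hB N f g
  have h' := isCatLeftGcd_of hl'
  rwa [hB.leftDivides_antisymm ((catLeftDivides_iff _ _).1 (h'.2.2 _ _ h.1 h.2.1))
    ((catLeftDivides_iff _ _).1 (h.2.2 _ _ h'.1 h'.2.1))]

theorem isCatRightLcm_iff {P Q R W : PosRibbon B Δ} {f : Q ⟶ P} {g : R ⟶ P} {l : W ⟶ P} :
    IsCatRightLcm f g l ↔ IsRightLcm B (elt f) (elt g) (elt l) := by
  refine ⟨fun h => ?_, isCatRightLcm_of⟩
  obtain ⟨W', l', hl'⟩ := exists_isRightLcm hB N f g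
  have h' := isCatRightLcm_of hl'
  rwa [hB.rightDivides_antisymm ((catRightDivides_iff _ _).1 (h.2.2 _ _ h'.1 h'.2.1))
    ((catRightDivides_iff _ _).1 (h'.2.2 _ _ h.1 h.2.1))]

theorem isCatRightGcd_iff {P Q R W : PosRibbon B Δ} {f : Q ⟶ P} {g : R ⟶ P} {l : W ⟶ P} :
    IsCatRightGcd f g l ↔ IsRightGcd B (elt f) (elt g) (elt l) := by
  refine ⟨fun h => ?_, isCatRightGcd_of⟩
  obtain ⟨W', l', hl'⟩ := exists_isRightGcd hB N f g
  have h' := isCatRightGcd_of hl'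
  rwa [hB.rightDivides_antisymm ((catRightDivides_iff _ _).1 (h'.2.2 _ _ h.1 h.2.1))
    ((catRightDivides_iff _ _).1 (h.2.2 _ _ h'.1 h'.2.1))]

end Lattice

/-! ### The Garside structure of the positive ribbon category -/

/-- Conjugation by `c`, as an endofunctor of the positive ribbon category. -/
def conjFunctor (hB : IsGarsideMonoid B Δ) {c : G} (hc : ConjTo c B B) (hcΔ : c * Δ = Δ * c) :
    PosRibbon B Δ ⥤ PosRibbon B Δ where
  obj P := P.conj hB hc hcΔ
  map {P Q} f := mk' (c⁻¹ * elt f * c) (hc.mem (elt_mem f)) (by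
    simpa [mul_assoc] using
      (conjTo_conj hB hc hcΔ P).inv.mul ((elt_conj f).mul (conjTo_conj hB hc hcΔ Q)))
  map_id P := elt_injective (by simp)
  map_comp f g := elt_injective (by simp [mul_assoc])

@[simp] theorem elt_conjFunctor_map (hB : IsGarsideMonoid B Δ) {c : G} (hc : ConjTo c B B)
    (hcΔ : c * Δ = Δ * c) {P Q : PosRibbon B Δ} (f : P ⟶ Q) :
    elt ((conjFunctor hB hc hcΔ).map f) = c⁻¹ * elt f * c := rfl

theorem conjFunctor_comp (hB : IsGarsideMonoid B Δ) {c d : G} (hc : ConjTo c B B)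
    (hcΔ : c * Δ = Δ * c) (hd : ConjTo d B B) (hdΔ : d * Δ = Δ * d) (hcd : c * d = 1) :
    conjFunctor hB hc hcΔ ⋙ conjFunctor hB hd hdΔ = 𝟭 _ := by
  refine CategoryTheory.Functor.ext (fun P => ?_) fun P Q f => elt_injective ?_
  · refine (eq_of_conjTo_one ?_).symm
    rw [← hcd]
    exact (conjTo_conj hB hc hcΔ P).mul (conjTo_conj hB hd hdΔ _)
  · obtain rfl := eq_inv_of_mul_eq_one_right hcd
    simp [mul_assoc]

/-- An infinite chain of factors in the positive ribbon category is eventually constant. -/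
theorem noetherian (hB : IsGarsideMonoid B Δ) (w : ℕ → Arrow (PosRibbon B Δ))
    (h : ∀ i, ∃ (a : (w i).left ⟶ (w (i + 1)).left) (b : (w (i + 1)).right ⟶ (w i).right),
      (w i).hom = a ≫ (w (i + 1)).hom ≫ b) : ∃ N, ∀ i, N ≤ i → w i = w N := by
  have h' : ∀ i, ∃ (a : (w i).left ⟶ (w (i + 1)).left) (b : (w (i + 1)).right ⟶ (w i).right),
      elt (w i).hom = elt a * elt (w (i + 1)).hom * elt b := fun i => by
    obtain ⟨a, b, e⟩ := h i
    refine ⟨a, b, ?_⟩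
    rw [e]
    simp [mul_assoc]
  obtain ⟨n, hn⟩ := hB.noetherian (fun i => elt (w i).hom) (fun i => elt_mem _) fun i => by
    obtain ⟨a, b, e⟩ := h' i
    exact ⟨_, elt_mem a, _, elt_mem b, e⟩
  have hext : ∀ u v : Arrow (PosRibbon B Δ), u.left = v.left → u.right = v.right →
      elt u.hom = elt v.hom → u = v := by
    rintro ⟨P, Q, f⟩ ⟨P', Q', f'⟩ h₁ h₂ h₃
    change P = P' at h₁
    change Q = Q' at h₂
    subst h₁ h₂
    exact congrArg Arrow.mk (elt_injective h₃)
  refine ⟨n, fun i hi => ?_⟩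
  induction i, hi using Nat.le_induction with
  | base => rfl
  | succ i hi ih =>
    rw [← ih]
    obtain ⟨a, b, e⟩ := h' i
    have heq : elt (w (i + 1)).hom = elt (w i).hom :=
      (hn (i + 1) (by omega)).trans (hn i hi).symm
    rw [heq] at e
    -- Stationarity in `B` only controls the underlying elements; it makes the connecting ribbons
    -- trivial, so the endpoints become stationary too.
    obtain ⟨ha, hb⟩ := hB.eq_one_of_eq_mul_mul (elt_mem a) (elt_mem b) (elt_mem _) e
    exact hext _ _ (eq_of_conjTo_one (ha ▸ elt_conj a)).symm
      (eq_of_conjTo_one (hb ▸ elt_conj b)) heq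

/-- The positive ribbon category of a Garside monoid with a `ν`-function is a Garside category. -/
def garsideStructure (hB : IsGarsideMonoid B Δ) (N : NuFunction B Δ) :
    CatGarsideStructure (PosRibbon B Δ) where
  Φ := conjFunctor hB hB.delta_conj rfl
  isCatAut := ⟨conjFunctor hB hB.delta_conj.inv (by simp),
    conjFunctor_comp _ _ _ _ _ (by simp), conjFunctor_comp _ _ _ _ _ (by simp)⟩
  Δ :=
    { app := fun P => mk' Δ hB.delta_mem (conjTo_conj hB hB.delta_conj rfl P)
      naturality := fun P Q f => elt_injective (by
        change elt f * Δ = Δ * (Δ⁻¹ * elt f * Δ)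
        simp [mul_assoc]) }
  left_cancel f g h e := elt_injective (by simpa using congrArg elt e)
  right_cancel f g h e := elt_injective (by simpa using congrArg elt e)
  noetherian := noetherian hB
  left_lcm f g := let ⟨W, l, h⟩ := exists_isLeftLcm hB N f g; ⟨W, l, isCatLeftLcm_of h⟩
  left_gcd f g := let ⟨W, l, h⟩ := exists_isLeftGcd hB N f g; ⟨W, l, isCatLeftGcd_of h⟩
  right_lcm f g := let ⟨W, l, h⟩ := exists_isRightLcm hB N f g; ⟨W, l, isCatRightLcm_of h⟩
  right_gcd f g := let ⟨W, l, h⟩ := exists_isRightGcd hB N f g; ⟨W, l, isCatRightGcd_of h⟩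
  atom_dvd {P Q} f hf := by
    have hf1 : elt f ≠ 1 := fun h => hf.1 ((isIdentity_iff f).2 h)
    obtain ⟨s, hs, -, R, v, e, hv, k, hk⟩ := N.exists_nu_leftDivides hB (isFrom_elt f) hf1
    -- An atom of the category coincides with the `ν_P(s)` dividing it. As `Δ` is a ribbon from `P`
    -- divisible by `s`, it is divisible by `ν_P(s)`.
    have hd : LeftDivides B (elt f) Δ := by
      have hvf : CatLeftDivides v f := (catLeftDivides_iff v f).2 ⟨k, hk⟩
      obtain ⟨k', rfl⟩ := hvf
      have hk' := (hf.2 R v k' rfl).resolve_left fun h => hv ((isIdentity_iff v).1 h)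
      rw [elt_comp, (isIdentity_iff k').1 hk', mul_one, e]
      exact N.nu_leftDivides hs ⟨hB.delta_mem, _, conjTo_conj hB hB.delta_conj rfl P⟩
        (hB.atom_dvd s hs)
    refine ⟨mk' _ (leftDivides_iff.1 hd)
      ((elt_conj f).inv_mul (conjTo_conj hB hB.delta_conj rfl P)), elt_injective ?_,
      elt_injective ?_⟩
    · change elt f * ((elt f)⁻¹ * Δ) = Δ
      simp
    · change (elt f)⁻¹ * Δ * (Δ⁻¹ * elt f * Δ) = Δ
      simp [mul_assoc]

 theorem elt_garsideStructure_app (hB : IsGarsideMonoid B Δ) (N : NuFunction B Δ)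
    (P : PosRibbon B Δ) : elt ((garsideStructure hB N).Δ.app P) = Δ := rfl

end PosRibbon

section

variable {G : Type u} [Group G] {B : Submonoid G} {Δ : G}

/-- An element of `X` that conjugates `X` to a submonoid stable under factors normalizes `X`. -/
theorem ConjTo.eq_of_mem {X Q : Submonoid G} {g : G} (h : ConjTo g X Q) (hg : g ∈ X)
    (hXB : X ≤ B) (hQB : Q ≤ B) (hX : FactorClosed B X) (hQ : FactorClosed B Q) : Q = X := by
  apply le_antisymm
  · intro q hq
    have h₁ := mul_mem (h.mem' hq) hg
    exact (hX g (hXB hg) q (hQB hq) (by simpa [mul_assoc] using h₁)).2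
  · intro x hx
    have h₁ := mul_mem (by simpa using h.mem hg : g ∈ Q) (h.mem hx)
    exact (hQ x (hXB hx) g (hXB hg) (by simpa [mul_assoc] using h₁)).1

theorem mem_of_mem_closure_of_atom {T : Set G} {s : G} (hT : T ⊆ atomSet B) (hs : s ∈ atomSet B)
    (h : s ∈ Submonoid.closure T) : s ∈ T := by
  have hTB : Submonoid.closure T ≤ B := Submonoid.closure_le.2 fun t ht => (hT ht).1
  suffices ∀ g ∈ Submonoid.closure T, g ∈ atomSet B → g ∈ T from this s h hs
  intro g hg
  induction hg using Submonoid.closure_induction_left with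
  | one => exact fun h => absurd rfl h.2.1
  | mul_left t ht k hk _ =>
    intro hat
    rcases hat.2.2 t (hT ht).1 k (hTB hk) rfl with h | h
    · exact absurd h (hT ht).2.1
    · rwa [h, mul_one]

theorem PosRibbon.factorClosed (hB : IsGarsideMonoid B Δ) (P : PosRibbon B Δ) :
    FactorClosed B P.carrier :=
  let ⟨_, h⟩ := P.isParabolic; h.factorClosed hB

theorem PosRibbon.le (P : PosRibbon B Δ) : P.carrier ≤ B := let ⟨_, h⟩ := P.isParabolic; h.le

/-! ### The monoid generated by the shakers. -/

namespace NuStructure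

open PosRibbon

/-- The setting of the theorem: the parabolic submonoid `X` with Garside element `ΔX`, and the
parabolic submonoid generated by `sh X`, with Garside element `δ`. -/
structure Setting (N : NuStructure B Δ) (X : PosRibbon B Δ) (ΔX δ : G) : Prop where
  garside : IsGarsideMonoid B Δ
  parabolic : IsParabolicWith B Δ X.carrier ΔX
  sh_parabolic : IsParabolicWith B Δ (Submonoid.closure (N.sh X)) δ

variable {N : NuStructure B Δ} {X : PosRibbon B Δ} {ΔX δ : G}

theorem mem_sh_of_conjTo {s : G} (hs : s ∈ atomSet B)
    (h : ConjTo (N.left.nu X s) X.carrier X.carrier) : s ∈ N.sh X := ⟨hs, s, hs, rfl, h⟩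

theorem conjTo_nu_of_mem_sh {s : G} (hs : s ∈ N.sh X) :
    ConjTo (N.left.nu X s) X.carrier X.carrier :=
  let ⟨_, _, _, _, h⟩ := hs; h

theorem exists_of_mem_SH {g : G} (hg : g ∈ N.SH X) :
    ∃ s ∈ N.sh X, g = N.left.nu X s := by
  obtain ⟨s, hs, rfl, h⟩ := hg
  exact ⟨s, mem_sh_of_conjTo hs h, rfl⟩

theorem nu_mem_SH {s : G} (hs : s ∈ N.sh X) : N.left.nu X s ∈ N.SH X :=
  ⟨s, hs.1, rfl, conjTo_nu_of_mem_sh hs⟩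

theorem SH_ne_one {g : G} (hg : g ∈ N.SH X) : g ≠ 1 := by
  obtain ⟨s, hs, rfl, -⟩ := hg
  obtain ⟨Q, f, e, hf⟩ := N.left.exists_hom X hs
  exact e ▸ hf

theorem conjTo_of_mem_SH {g : G} (hg : g ∈ N.SH X) : ConjTo g X.carrier X.carrier :=
  let ⟨_, _, _, h⟩ := hg; h

theorem mem_sh_of_mem_closure {s : G} (hs : s ∈ atomSet B)
    (h : s ∈ Submonoid.closure (N.sh X)) : s ∈ N.sh X :=
  mem_of_mem_closure_of_atom (fun _ ht => ht.1) hs h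

theorem nu_mem {s : G} (hs : s ∈ atomSet B) : N.left.nu X s ∈ B := by
  obtain ⟨Q, f, e, -⟩ := N.left.exists_hom X hs
  exact e ▸ elt_mem f

theorem conjTo_of_mem_closure_SH {g : G} (hg : g ∈ Submonoid.closure (N.SH X)) :
    ConjTo g X.carrier X.carrier := by
  induction hg using Submonoid.closure_induction with
  | mem x hx => exact conjTo_of_mem_SH hx
  | one => exact ConjTo.one _
  | mul x y _ _ hx hy => exact hx.mul hy

/-! ### The parabolic subcategory -/

/-- The subcategory with unique object `X` and vertex monoid generated by the shakers. -/
def shakerSubCat (N : NuStructure B Δ) (X : PosRibbon B Δ) : SubCat (PosRibbon B Δ) where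
  objs := {X}
  arrows P Q := {f | P = X ∧ Q = X ∧ elt f ∈ Submonoid.closure (N.SH X)}
  mem_objs h := ⟨h.1, h.2.1⟩
  id_mem h := ⟨h, h, one_mem _⟩
  comp_mem hf hg := ⟨hf.1, hg.2.1, mul_mem hf.2.2 hg.2.2⟩

/-- Conjugation by `c` as an endofunctor of the subcategory of shakers. -/
def conjShaker {c : G} (hcB : ConjTo c (Submonoid.closure (N.SH X)) (Submonoid.closure (N.SH X)))
    (hcX : ConjTo c X.carrier X.carrier) (hle : Submonoid.closure (N.SH X) ≤ B) :
    (shakerSubCat N X).Obj ⥤ (shakerSubCat N X).Obj where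
  obj P := P
  map {P Q} f := ⟨mk' (c⁻¹ * elt f.1 * c) (hle (hcB.mem f.2.2.2)) (by
      have key : ∀ P' Q' : PosRibbon B Δ, P' = X → Q' = X →
          ConjTo (c⁻¹ * elt f.1 * c) P'.carrier Q'.carrier := by
        rintro P' Q' hP hQ
        rw [hP, hQ]
        simpa [mul_assoc] using hcX.inv.mul ((conjTo_of_mem_closure_SH f.2.2.2).mul hcX)
      exact key _ _ P.mem Q.mem), P.mem, Q.mem, hcB.mem f.2.2.2⟩
  map_id P := Subtype.ext (elt_injective (by
    change c⁻¹ * 1 * c = 1; simp))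
  map_comp f g := Subtype.ext (elt_injective (by
    change c⁻¹ * (elt f.1 * elt g.1) * c = c⁻¹ * elt f.1 * c * (c⁻¹ * elt g.1 * c)
    simp [mul_assoc]))

theorem conjShaker_comp {c d : G}
    (hcB : ConjTo c (Submonoid.closure (N.SH X)) (Submonoid.closure (N.SH X)))
    (hcX : ConjTo c X.carrier X.carrier)
    (hdB : ConjTo d (Submonoid.closure (N.SH X)) (Submonoid.closure (N.SH X)))
    (hdX : ConjTo d X.carrier X.carrier) (hle : Submonoid.closure (N.SH X) ≤ B)
    (hcd : c * d = 1) : conjShaker hcB hcX hle ⋙ conjShaker hdB hdX hle = 𝟭 _ := by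
  refine CategoryTheory.Functor.ext (fun P => rfl) fun P Q f => ?_
  refine Subtype.ext (elt_injective ?_)
  change d⁻¹ * (c⁻¹ * elt f.1 * c) * d = 1 * (elt f.1 * 1)
  obtain rfl := eq_inv_of_mul_eq_one_right hcd
  simp [mul_assoc]

namespace Setting

variable (S : Setting N X ΔX δ)
include S

theorem isFrom_delta : X.IsFrom ΔX := ⟨S.parabolic.delta_mem, X, S.parabolic.delta_conj⟩

/-- For an atom `s` of `X`, the ribbon `ΔX` is divisible by `s`, hence by `ν_X(s)`, which therefore
lies in `X`. An element of `X` can conjugate `X` to no other parabolic submonoid, so `ν_X(s)` is a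
shaker. -/
theorem carrier_le : X.carrier ≤ Submonoid.closure (N.sh X) := by
  have hB := S.garside
  have hX := S.parabolic.factorClosed hB
  refine hX.le_closure hB X.le fun s hs hsX => ?_
  obtain ⟨Q, f, e, hf⟩ := N.left.exists_hom X hs
  refine mem_sh_of_conjTo hs ?_
  have hd := N.left.nu_leftDivides hs S.isFrom_delta
    ((S.parabolic.interval_iff hs.1).2 ⟨hB.atom_dvd s hs, hsX⟩)
  rw [← e] at hd ⊢
  have hfX := hX.left (elt_mem f) S.parabolic.delta_mem_self hd
  have := (elt_conj f).eq_of_mem hfX X.le Q.le hX (Q.factorClosed hB)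
  simpa only [this] using elt_conj f

/-- The conjugate of `X` by `δ` is parabolic because `X` sits inside the monoid generated by `sh X`,
which `δ` normalizes. That this conjugate is `X` itself only follows in `conjTo_delta_sh`. -/
theorem isFrom_delta_sh : X.IsFrom δ :=
  ⟨S.sh_parabolic.delta_mem, ⟨conjSubmonoid δ X.carrier, _, S.parabolic.conj S.garside
    S.sh_parabolic S.carrier_le S.sh_parabolic.delta_conj rfl⟩, conjTo_conjSubmonoid _ _⟩

theorem nu_leftDivides_delta {s : G} (hs : s ∈ N.sh X) : LeftDivides B (N.left.nu X s) δ :=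
  N.left.nu_leftDivides hs.1 S.isFrom_delta_sh ((S.sh_parabolic.interval_iff hs.1.1).2
    ⟨S.garside.atom_dvd s hs.1, Submonoid.subset_closure hs⟩)

theorem factorClosed_sh : FactorClosed B (Submonoid.closure (N.sh X)) :=
  S.sh_parabolic.factorClosed S.garside

theorem SH_leftDivides_delta {g : G} (hg : g ∈ N.SH X) : LeftDivides B g δ := by
  obtain ⟨s, hs, rfl⟩ := exists_of_mem_SH hg
  exact S.nu_leftDivides_delta hs

theorem SH_mem {g : G} (hg : g ∈ N.SH X) : g ∈ Submonoid.closure (N.sh X) := by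
  obtain ⟨s, hs, rfl⟩ := exists_of_mem_SH hg
  exact S.factorClosed_sh.left (nu_mem hs.1) S.sh_parabolic.delta_mem_self
    (S.nu_leftDivides_delta hs)

/-- A nontrivial positive ribbon with source `X` that lies in the monoid generated by `sh X` is
left-divisible by a shaker. -/
theorem exists_SH_leftDivides {g : G} (hg : X.IsFrom g) (hgs : g ∈ Submonoid.closure (N.sh X))
    (h1 : g ≠ 1) : ∃ v ∈ N.SH X, LeftDivides B v g := by
  obtain ⟨s, hs, hd⟩ := S.garside.exists_atom_leftDivides hg.1 h1
  have hsh := mem_sh_of_mem_closure hs (S.factorClosed_sh.left hs.1 hgs hd)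
  exact ⟨_, nu_mem_SH hsh, N.left.nu_leftDivides hs hg hd⟩

/-- Each shaker peeled off from the left ends at `X`, so the quotient starts at `X` again. In
particular the ribbon must end at `X`. -/
theorem mem_closure_SH_of_isFrom {g : G} (hg : X.IsFrom g)
    (hgs : g ∈ Submonoid.closure (N.sh X)) : g ∈ Submonoid.closure (N.SH X) := by
  refine S.garside.quotient_induction (C := fun g => X.IsFrom g →
    g ∈ Submonoid.closure (N.sh X) → g ∈ Submonoid.closure (N.SH X)) (fun g _ ih hg hgs => ?_) g
    hg.1 hg hgs
  by_cases h1 : g = 1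
  · rw [h1]; exact one_mem _
  obtain ⟨v, hv, hd⟩ := S.exists_SH_leftDivides hg hgs h1
  have hvB : v ∈ B := S.sh_parabolic.le (S.SH_mem hv)
  have hk := S.factorClosed_sh.quotient hvB hgs hd
  have hkF : X.IsFrom (v⁻¹ * g) :=
    hg.inv_mul (mk' v hvB (conjTo_of_mem_SH hv) : X ⟶ X) hd
  have := ih v hvB _ hkF.1 (SH_ne_one hv) (by simpa using LeftDivides.refl B g) hkF hk
  simpa using mul_mem (Submonoid.subset_closure hv) this

theorem closure_SH_le : Submonoid.closure (N.SH X) ≤ Submonoid.closure (N.sh X) :=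
  Submonoid.closure_le.2 fun _ h => S.SH_mem h

theorem mem_closure_SH_iff {g : G} : g ∈ Submonoid.closure (N.SH X) ↔
    g ∈ Submonoid.closure (N.sh X) ∧ ConjTo g X.carrier X.carrier :=
  ⟨fun h => ⟨S.closure_SH_le h, conjTo_of_mem_closure_SH h⟩,
    fun ⟨h, h'⟩ => S.mem_closure_SH_of_isFrom ⟨S.sh_parabolic.le h, X, h'⟩ h⟩

theorem closure_SH_le_B : Submonoid.closure (N.SH X) ≤ B := S.closure_SH_le.trans S.sh_parabolic.le

theorem isFrom_of_mem {g : G} (hg : g ∈ Submonoid.closure (N.SH X)) : X.IsFrom g :=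
  ⟨S.closure_SH_le_B hg, X, conjTo_of_mem_closure_SH hg⟩

theorem isTo_of_mem {g : G} (hg : g ∈ Submonoid.closure (N.SH X)) : X.IsTo g :=
  ⟨S.closure_SH_le_B hg, X, conjTo_of_mem_closure_SH hg⟩

theorem delta_sh_mem : δ ∈ Submonoid.closure (N.SH X) :=
  S.mem_closure_SH_of_isFrom S.isFrom_delta_sh S.sh_parabolic.delta_mem_self

theorem conjTo_delta_sh : ConjTo δ X.carrier X.carrier := conjTo_of_mem_closure_SH S.delta_sh_mem

theorem isGarsideMonoid_sh : IsGarsideMonoid (Submonoid.closure (N.sh X)) δ :=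
  S.sh_parabolic.isGarsideMonoid S.garside

/-- Write `δ ^ n = k * g`. The cofactor `k` is a ribbon from `X`, hence a product of shakers, hence
ends at `X`; so `g` also starts at `X`. -/
theorem mem_closure_SH_of_isTo {g : G} (hg : X.IsTo g)
    (hgs : g ∈ Submonoid.closure (N.sh X)) : g ∈ Submonoid.closure (N.SH X) := by
  obtain ⟨n, hn⟩ := S.isGarsideMonoid_sh.exists_rightDivides_pow hgs
  obtain ⟨k, hk, e⟩ := hn n le_rfl
  obtain ⟨hgB, Q, hQ⟩ := hg
  have hkc : ConjTo k X.carrier Q.carrier := by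
    rw [eq_mul_inv_of_mul_eq e.symm]
    exact (S.conjTo_delta_sh.pow n).mul_inv hQ
  have hkS := S.mem_closure_SH_of_isFrom ⟨S.sh_parabolic.le hk, Q, hkc⟩ hk
  have := (conjTo_of_mem_closure_SH hkS).unique hkc
  exact S.mem_closure_SH_iff.2 ⟨hgs, by rwa [← this] at hQ⟩

theorem leftDivides_closure_SH {a b : G} (ha : a ∈ Submonoid.closure (N.SH X))
    (hb : b ∈ Submonoid.closure (N.SH X)) (hd : LeftDivides B a b) :
    LeftDivides (Submonoid.closure (N.SH X)) a b := by
  rw [S.mem_closure_SH_iff] at ha hb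
  rw [leftDivides_iff, S.mem_closure_SH_iff]
  exact ⟨S.factorClosed_sh.quotient (S.sh_parabolic.le ha.1) hb.1 hd, ha.2.inv_mul hb.2⟩

theorem rightDivides_closure_SH {a b : G} (ha : a ∈ Submonoid.closure (N.SH X))
    (hb : b ∈ Submonoid.closure (N.SH X)) (hd : RightDivides B a b) :
    RightDivides (Submonoid.closure (N.SH X)) a b := by
  rw [S.mem_closure_SH_iff] at ha hb
  obtain ⟨k, hk, rfl⟩ := hd
  refine ⟨k, S.mem_closure_SH_iff.2 ⟨(S.factorClosed_sh k hk a (S.sh_parabolic.le ha.1) hb.1).1,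
    ?_⟩, rfl⟩
  simpa using hb.2.mul_inv ha.2

theorem leftLcm_mem {g h l : G} (hg : g ∈ Submonoid.closure (N.SH X))
    (hh : h ∈ Submonoid.closure (N.SH X)) (hl : IsLeftLcm B g h l) :
    l ∈ Submonoid.closure (N.SH X) :=
  S.mem_closure_SH_of_isFrom
    (N.left.isFrom_leftLcm S.garside hl.1 X g h (S.isFrom_of_mem hg) (S.isFrom_of_mem hh) hl)
    (S.sh_parabolic.left_lcm_mem g (S.closure_SH_le hg) h (S.closure_SH_le hh) l hl)

theorem leftGcd_mem {g h l : G} (hg : X.IsFrom g)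
    (hh : h ∈ Submonoid.closure (N.SH X)) (hl : IsLeftGcd B g h l) :
    l ∈ Submonoid.closure (N.SH X) :=
  S.mem_closure_SH_of_isFrom
    (N.left.isFrom_leftGcd S.garside hl.1 X g h hg (S.isFrom_of_mem hh) hl)
    (S.factorClosed_sh.left hl.1 (S.closure_SH_le hh) hl.2.2.1)

theorem rightLcm_mem {g h l : G} (hg : g ∈ Submonoid.closure (N.SH X))
    (hh : h ∈ Submonoid.closure (N.SH X)) (hl : IsRightLcm B g h l) :
    l ∈ Submonoid.closure (N.SH X) :=
  S.mem_closure_SH_of_isTo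
    (isTo_rightLcm S.garside N.left (S.isTo_of_mem hg) (S.isTo_of_mem hh) hl)
    (S.sh_parabolic.right_lcm_mem g (S.closure_SH_le hg) h (S.closure_SH_le hh) l hl)

theorem rightGcd_mem {g h l : G} (hg : g ∈ Submonoid.closure (N.SH X))
    (hh : h ∈ Submonoid.closure (N.SH X)) (hl : IsRightGcd B g h l) :
    l ∈ Submonoid.closure (N.SH X) :=
  S.mem_closure_SH_of_isTo
    (isTo_rightGcd S.garside N.left (S.isTo_of_mem hg) (S.isTo_of_mem hh) hl)
    (S.factorClosed_sh.right hl.1 (S.closure_SH_le hh) hl.2.2.1)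

theorem conjTo_delta_closure_SH :
    ConjTo δ (Submonoid.closure (N.SH X)) (Submonoid.closure (N.SH X)) := by
  have key : ∀ c, ConjTo c (Submonoid.closure (N.sh X)) (Submonoid.closure (N.sh X)) →
      ConjTo c X.carrier X.carrier → ∀ x ∈ Submonoid.closure (N.SH X),
        c⁻¹ * x * c ∈ Submonoid.closure (N.SH X) := fun c hc hcX x hx => by
    rw [S.mem_closure_SH_iff] at hx ⊢
    exact ⟨hc.mem hx.1, by simpa [mul_assoc] using hcX.inv.mul (hx.2.mul hcX)⟩
  have hc := S.sh_parabolic.delta_conj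
  have hX := S.conjTo_delta_sh
  exact fun x => ⟨key δ hc hX x, fun h => by
    simpa [mul_assoc] using key _ hc.inv hX.inv _ h⟩

theorem exists_SH_leftDivides_of_mem {g : G} (hg : g ∈ Submonoid.closure (N.SH X)) (h1 : g ≠ 1) :
    ∃ v ∈ N.SH X, LeftDivides (Submonoid.closure (N.SH X)) v g := by
  obtain ⟨v, hv, hd⟩ := S.exists_SH_leftDivides (S.isFrom_of_mem hg) (S.closure_SH_le hg) h1
  exact ⟨v, hv, S.leftDivides_closure_SH (Submonoid.subset_closure hv) hg hd⟩

theorem atomSet_closure_SH : atomSet (Submonoid.closure (N.SH X)) = N.SH X := by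
  ext g
  constructor
  · intro hg
    obtain ⟨v, hv, k, hk, rfl⟩ := S.exists_SH_leftDivides_of_mem hg.1 hg.2.1
    rcases hg.2.2 v (Submonoid.subset_closure hv) k hk rfl with h | h
    · exact absurd h (SH_ne_one hv)
    · rwa [h, mul_one]
  · intro hg
    refine ⟨Submonoid.subset_closure hg, SH_ne_one hg, ?_⟩
    obtain ⟨s, hs, rfl⟩ := exists_of_mem_SH hg
    intro a ha b hb e
    obtain ⟨Q, f, ef, hf⟩ := N.left.atom X s hs.1
    have hQ : X.carrier = Q.carrier :=
      (conjTo_nu_of_mem_sh hs).unique (ef ▸ elt_conj f)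
    -- A factorization inside the shaker monoid is one through the object `X`, so atomicity of
    -- `ν_X(s)` in the ribbon category applies.
    have := hf.2 X (mk' a (S.closure_SH_le_B ha) (conjTo_of_mem_closure_SH ha))
      (mk' b (S.closure_SH_le_B hb) (hQ ▸ conjTo_of_mem_closure_SH hb)) (elt_injective (ef.trans e))
    simpa only [isIdentity_iff, elt_mk'] using this

theorem isGarsideMonoid_closure_SH : IsGarsideMonoid (Submonoid.closure (N.SH X)) δ :=
  S.garside.of_sublattice S.closure_SH_le_B (fun _ ha _ hb => S.leftDivides_closure_SH ha hb)
    (fun _ ha _ hb => S.rightDivides_closure_SH ha hb) (fun _ hg _ hh _ => S.leftLcm_mem hg hh)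
    (fun _ hg _ hh _ => S.leftGcd_mem (S.isFrom_of_mem hg) hh)
    (fun _ hg _ hh _ => S.rightLcm_mem hg hh) (fun _ hg _ hh _ => S.rightGcd_mem hg hh)
    S.delta_sh_mem S.conjTo_delta_closure_SH
    fun _ hs => S.SH_leftDivides_delta (S.atomSet_closure_SH ▸ hs)

theorem isGarsideGroup_closure_SH :
    IsGarsideGroup (Subgroup.closure (N.SH X)) (Submonoid.closure (N.SH X)) δ where
  garside := S.isGarsideMonoid_closure_SH
  le := Submonoid.closure_le.2 Subgroup.subset_closure
  fraction g hg := by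
    obtain ⟨a, ha, n, rfl⟩ := S.isGarsideMonoid_closure_SH.exists_fraction
      (Subgroup.closure_mono Submonoid.subset_closure hg)
    exact ⟨a, ha, _, pow_mem S.delta_sh_mem n, rfl⟩

/-- The Garside map of the subcategory of shakers. -/
def shakerDelta : (shakerSubCat N X).incl ⟶
    conjShaker S.conjTo_delta_closure_SH S.conjTo_delta_sh S.closure_SH_le_B ⋙
      (shakerSubCat N X).incl where
  app P := mk' (P := P.pt) (Q := P.pt) δ S.sh_parabolic.delta_mem (by
    have hP : P.pt = X := P.mem
    rw [hP]; exact S.conjTo_delta_sh)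
  naturality P Q f := elt_injective (by
    change elt f.1 * δ = δ * (δ⁻¹ * elt f.1 * δ)
    simp [mul_assoc])

theorem elt_shakerDelta_app (P : (shakerSubCat N X).Obj) : elt (S.shakerDelta.app P) = δ := rfl

theorem mem_shakerSubCat_of_isFrom {P Q : PosRibbon B Δ} (f : P ⟶ Q) (hP : P = X)
    (hf : elt f ∈ Submonoid.closure (N.sh X)) : f ∈ (shakerSubCat N X).arrows P Q := by
  subst hP
  have h := S.mem_closure_SH_of_isFrom (isFrom_elt f) hf
  exact ⟨rfl, PosRibbon.ext ((elt_conj f).unique (conjTo_of_mem_closure_SH h)), h⟩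

theorem mem_shakerSubCat_of_isTo {P Q : PosRibbon B Δ} (f : Q ⟶ P) (hP : P = X)
    (hf : elt f ∈ Submonoid.closure (N.sh X)) : f ∈ (shakerSubCat N X).arrows Q P := by
  subst hP
  have h := S.mem_closure_SH_of_isTo (isTo_elt f) hf
  exact ⟨PosRibbon.ext ((elt_conj f).inv.unique (conjTo_of_mem_closure_SH h).inv), rfl, h⟩

/-- Both interval conditions are those of the monoid generated by `sh X`, since a ribbon from `X`
lying in that monoid is an arrow of the subcategory, whatever target it was given. -/
theorem isParabolicWith_shakerSubCat :
    (shakerSubCat N X).IsParabolicWith (garsideStructure S.garside N.left) _ S.shakerDelta where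
  left_lcm_mem g hg h hh l hl := by
    rw [isCatLeftLcm_iff S.garside N.left] at hl
    exact S.mem_shakerSubCat_of_isFrom l hg.1 (S.closure_SH_le (S.leftLcm_mem hg.2.2 hh.2.2 hl))
  left_gcd_mem g hg h hh l hl := by
    rw [isCatLeftGcd_iff S.garside N.left] at hl
    exact S.mem_shakerSubCat_of_isFrom l hg.1
      (S.closure_SH_le (S.leftGcd_mem (S.isFrom_of_mem hg.2.2) hh.2.2 hl))
  right_lcm_mem g hg h hh l hl := by
    rw [isCatRightLcm_iff S.garside N.left] at hl
    exact S.mem_shakerSubCat_of_isTo l hg.2.1 (S.closure_SH_le (S.rightLcm_mem hg.2.2 hh.2.2 hl))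
  right_gcd_mem g hg h hh l hl := by
    rw [isCatRightGcd_iff S.garside N.left] at hl
    exact S.mem_shakerSubCat_of_isTo l hg.2.1 (S.closure_SH_le (S.rightGcd_mem hg.2.2 hh.2.2 hl))
  isCatAut := ⟨conjShaker (by exact S.conjTo_delta_closure_SH.inv) S.conjTo_delta_sh.inv
    S.closure_SH_le_B, conjShaker_comp _ _ _ _ _ (by simp), conjShaker_comp _ _ _ _ _ (by simp)⟩
  interval_iff_inter P Q g := by
    have hP : P.pt = X := P.mem
    have h : CatLeftDivides g (S.shakerDelta.app P) ↔ LeftDivides B (elt g) δ :=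
      catLeftDivides_iff g _
    have h' : CatLeftDivides g ((garsideStructure S.garside N.left).Δ.app P.pt) ↔
      LeftDivides B (elt g) Δ := catLeftDivides_iff g _
    rw [h, h', S.sh_parabolic.interval_iff (elt_mem g)]
    exact and_congr_right fun _ => ⟨S.mem_shakerSubCat_of_isFrom g hP,
      fun hg => S.closure_SH_le hg.2.2⟩
  interval_iff_gcd P Q g := by
    have hP : P.pt = X := P.mem
    have h : CatLeftDivides g (S.shakerDelta.app P) ↔ LeftDivides B (elt g) δ :=
      catLeftDivides_iff g _
    have h' : ∀ (Z : PosRibbon B Δ) (k : P.pt ⟶ Z),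
        IsCatLeftGcd ((garsideStructure S.garside N.left).Δ.app P.pt) k g ↔
          IsLeftGcd B Δ (elt k) (elt g) := fun Z k => isCatLeftGcd_iff S.garside N.left
    simp only [h, h', S.sh_parabolic.interval_iff (elt_mem g)]
    constructor
    · rintro ⟨h₁, h₂⟩
      exact ⟨Q, g, S.mem_shakerSubCat_of_isFrom g hP h₂, elt_mem g, h₁, LeftDivides.refl _ _,
        fun m _ _ hm => hm⟩
    · rintro ⟨Z, k, hk, hgcd⟩
      exact ⟨hgcd.2.1, S.factorClosed_sh.left (elt_mem g) (S.closure_SH_le hk.2.2) hgcd.2.2.1⟩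

end Setting

end NuStructure

/-! ### The subgroupoid generated by a one-object subcategory -/

/-- The subgroupoid of the ribbon groupoid with unique object `X` and vertex group `H`. -/
def Ribbon.vertexSubgroupoid (X : Ribbon B Δ) (H : Subgroup G) : Subgroupoid (Ribbon B Δ) where
  arrows P Q := {f | P = X ∧ Q = X ∧ Ribbon.elt f ∈ H}
  inv h := ⟨h.2.1, h.1, inv_mem h.2.2⟩
  mul h _ h' := ⟨h.1, h'.2.1, mul_mem h.2.2 h'.2.2⟩

theorem generatedSubgroupoid_shakerSubCat (N : NuStructure B Δ) (X : PosRibbon B Δ)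
    (hle : Submonoid.closure (N.SH X) ≤ B) :
    ((NuStructure.shakerSubCat N X).generatedSubgroupoid (Ribbon.ofPos B Δ)).objs =
        {(Ribbon.ofPos B Δ).obj X} ∧
      Ribbon.elt '' ((NuStructure.shakerSubCat N X).generatedSubgroupoid
        (Ribbon.ofPos B Δ)).arrows ((Ribbon.ofPos B Δ).obj X) ((Ribbon.ofPos B Δ).obj X) =
        (Subgroup.closure (N.SH X) : Set G) := by
  set 𝒟 := NuStructure.shakerSubCat N X
  set X' := (Ribbon.ofPos B Δ).obj X
  have hH : Submonoid.closure (N.SH X) ≤ (Subgroup.closure (N.SH X)).toSubmonoid :=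
    Submonoid.closure_le.2 Subgroup.subset_closure
  have hle' : 𝒟.generatedSubgroupoid (Ribbon.ofPos B Δ) ≤
      Ribbon.vertexSubgroupoid X' (Subgroup.closure (N.SH X)) := by
    refine sInf_le ?_
    rintro P Q f ⟨rfl, rfl, hf⟩
    exact ⟨rfl, rfl, hH hf⟩
  have hmem : ∀ g ∈ Subgroup.closure (N.SH X), ∃ f : X' ⟶ X', Ribbon.elt f = g ∧
      f ∈ (𝒟.generatedSubgroupoid (Ribbon.ofPos B Δ)).arrows X' X' := by
    intro g hg
    induction hg using Subgroup.closure_induction with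
    | mem g hg =>
      have hg' := Submonoid.subset_closure (s := N.SH X) hg
      refine ⟨(Ribbon.ofPos B Δ).map
        (PosRibbon.mk' g (hle hg') (NuStructure.conjTo_of_mem_SH hg) : X ⟶ X), rfl, ?_⟩
      exact Subgroupoid.mem_sInf_arrows.2 fun T hT => hT X X _ ⟨rfl, rfl, hg'⟩
    | one =>
      exact ⟨(Ribbon.ofPos B Δ).map (𝟙 X), rfl, Subgroupoid.mem_sInf_arrows.2 fun T hT =>
        hT X X _ (𝒟.id_mem rfl)⟩
    | mul a b _ _ ha hb =>
      obtain ⟨f, rfl, hf⟩ := ha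
      obtain ⟨f', rfl, hf'⟩ := hb
      exact ⟨f ≫ f', rfl, Subgroupoid.mul _ hf hf'⟩
    | inv a _ ha =>
      obtain ⟨f, rfl, hf⟩ := ha
      exact ⟨Groupoid.inv f, rfl, Subgroupoid.inv _ hf⟩
  constructor
  · ext P
    constructor
    · rintro ⟨f, hf⟩
      exact ((Subgroupoid.le_iff _ _).1 hle' hf).1
    · rintro rfl
      obtain ⟨f, -, hf⟩ := hmem 1 (one_mem _)
      exact ⟨f, hf⟩
  · ext g
    constructor
    · rintro ⟨f, hf, rfl⟩
      exact ((Subgroupoid.le_iff _ _).1 hle' hf).2.2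
    · intro hg
      obtain ⟨f, hf, hf'⟩ := hmem g hg
      exact ⟨f, hf', hf⟩

theorem NuStructure.Setting.isStandardParabolicInRibbon {N : NuStructure B Δ} {X : PosRibbon B Δ}
    {ΔX δ : G} (S : N.Setting X ΔX δ) :
    IsStandardParabolicInRibbon (PosRibbon.garsideStructure S.garside N.left) X
      (Subgroup.closure (N.SH X)) (Submonoid.closure (N.SH X)) δ := by
  refine ⟨_, _, _, S.isParabolicWith_shakerSubCat, rfl, ?_, S.elt_shakerDelta_app,
    generatedSubgroupoid_shakerSubCat N X S.closure_SH_le_B⟩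
  ext g
  constructor
  · rintro ⟨f, hf, rfl⟩
    exact hf.2.2
  · intro hg
    exact ⟨PosRibbon.mk' g (S.closure_SH_le_B hg) (NuStructure.conjTo_of_mem_closure_SH hg),
      ⟨rfl, rfl, hg⟩, rfl⟩

end

/-! ### Elements without left-divisors in a parabolic submonoid. -/

section

variable {G : Type u} [Group G] {B P : Submonoid G} {Δ δ : G}

/-- `g` has no nontrivial left-divisor in `P`. -/
def Reduced (B P : Submonoid G) (g : G) : Prop := ∀ x ∈ P, LeftDivides B x g → x = 1

namespace Reduced

theorem left {g h : G} (hh : Reduced B P h) (hd : LeftDivides B g h) : Reduced B P g :=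
  fun x hx hxg => hh x hx (hxg.trans hd)

theorem right {g k : G} (hg : ConjTo g P P) (hgB : g ∈ B) (h : Reduced B P (g * k)) :
    Reduced B P k := fun x hx hxk => by
  have h₁ : LeftDivides B (g * x * g⁻¹) (g * k) :=
    LeftDivides.trans ⟨g, hgB, by simp⟩ ((leftDivides_mul_left_iff g).2 hxk)
  simpa using h _ (hg.mem' hx) h₁

/-- The lcm of `c` and `d` lies in `P` and divides `d * a`; its quotient by `d` divides the reduced
`a`, so it is trivial. This yields uniqueness of the `P`-part of a product. -/
theorem leftDivides_of_mul (hB : IsGarsideMonoid B Δ) (hP : IsParabolicWith B Δ P δ) {a c d : G}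
    (ha : a ∈ B) (hr : Reduced B P a) (hc : c ∈ P) (hd : d ∈ P) (h : LeftDivides B c (d * a)) :
    LeftDivides B c d := by
  obtain ⟨l, hl⟩ := hB.left_lcm c (hP.le hc) d (hP.le hd)
  have hlP := hP.left_lcm_mem c hc d hd l hl
  have h₁ := hl.2.2.2 _ (mul_mem (hP.le hd) ha) h (leftDivides_mul_right ha)
  have h₂ := hr _ ((hP.factorClosed hB).quotient (hP.le hd) hlP hl.2.2.1)
    (inv_mul_leftDivides_iff.2 h₁)
  rw [inv_mul_eq_one.1 h₂]
  exact hl.2.1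

/-- If `g` is reduced and normalizes `P`, then the lcm of `g` and `x ∈ P` is `x * g`. -/
theorem mul_leftDivides (hB : IsGarsideMonoid B Δ) (hP : IsParabolicWith B Δ P δ) {g x m : G}
    (hgB : g ∈ B) (hg : ConjTo g P P) (hr : Reduced B P g) (hx : x ∈ P) (hm : m ∈ B)
    (hxm : LeftDivides B x m) (hgm : LeftDivides B g m) : LeftDivides B (x * g) m := by
  have hF := hP.factorClosed hB
  obtain ⟨l, hl⟩ := hB.left_lcm x (hP.le hx) g hgB
  have h₁ : LeftDivides B l (x * g) := hl.2.2.2 _ (mul_mem (hP.le hx) hgB)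
    (leftDivides_mul_right hgB) ⟨_, hP.le (hg.mem hx), by simp [mul_assoc]⟩
  -- As `x * g = g * (g⁻¹ * x * g)`, the lcm `l` is `g` times a factor of an element of `P`. Hence
  -- `l = p * g` with `p` in `P`, and reducedness forces `x` to divide `p`.
  have h₂ : g⁻¹ * l ∈ P := hF.left (leftDivides_iff.1 hl.2.2.1) (hg.mem hx) (by
    rw [mul_assoc]; exact (leftDivides_mul_left_iff _).2 h₁)
  have h₃ : l * g⁻¹ ∈ P := by simpa using hg.mem' h₂
  have h₄ : LeftDivides B x (l * g⁻¹) :=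
    leftDivides_of_mul hB hP hgB hr hx h₃ (by simpa using hl.2.1)
  have h₅ := hg.mem (hF.quotient (hP.le hx) h₃ h₄)
  refine LeftDivides.trans ?_ (hl.2.2.2 m hm hxm hgm)
  rw [leftDivides_iff]
  simpa [mul_assoc] using hP.le h₅

theorem mul (hB : IsGarsideMonoid B Δ) (hP : IsParabolicWith B Δ P δ) {g h : G}
    (hgB : g ∈ B) (hg : ConjTo g P P) (hr : Reduced B P g) (hhB : h ∈ B) (hr' : Reduced B P h) :
    Reduced B P (g * h) := fun x hx hd => by
  have h₁ := mul_leftDivides hB hP hgB hg hr hx (mul_mem hgB hhB) hd (leftDivides_mul_right hhB)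
  have h₂ : LeftDivides B (g⁻¹ * x * g) h := by
    rw [mul_assoc, inv_mul_leftDivides_iff]; exact h₁
  have h₃ := hr' _ (hg.mem hx) h₂
  rw [mul_assoc, inv_mul_eq_one] at h₃
  exact right_eq_mul.1 h₃

end Reduced

theorem ConjTo.conj_mem_subgroupClosure {g k : G} (hk : ConjTo k P P)
    (hg : g ∈ Subgroup.closure (P : Set G)) : k * g * k⁻¹ ∈ Subgroup.closure (P : Set G) := by
  induction hg using Subgroup.closure_induction with
  | mem x hx => exact Subgroup.subset_closure (hk.mem' hx)
  | one => simp
  | mul x y _ _ hx hy => simpa [mul_assoc] using mul_mem hx hy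
  | inv x _ hx => simpa [mul_assoc] using inv_mem hx

theorem conj_mem_quasiCentralizer {g k : G} (hk : ConjTo k P P) (hg : g ∈ quasiCentralizer P) :
    k * g * k⁻¹ ∈ quasiCentralizer P :=
  ⟨hk.conj_mem_subgroupClosure hg.1, (hk.mul hg.2).mul hk.inv⟩

theorem isInternalSemidirect_of {H N K : Subgroup G} (hN : N ≤ H) (hK : K ≤ H)
    (hnormal : ∀ g ∈ N, ∀ k ∈ H, k * g * k⁻¹ ∈ N) (hdisj : ∀ g ∈ N, g ∈ K → g = 1)
    (hmul : ∀ g ∈ H, ∃ a ∈ N, ∃ b ∈ K, g = a * b) : IsInternalSemidirect H N K := by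
  refine ⟨hN, hK, (Subgroup.normal_subgroupOf_iff hN).2 fun g k hg hk => hnormal g hg k hk,
    Subgroup.isComplement'_of_disjoint_and_mul_eq_univ ?_ ?_⟩
  · rw [Subgroup.disjoint_def]
    intro x hx hx'
    exact Subtype.ext (hdisj _ hx hx')
  · refine Set.eq_univ_of_forall fun g => ?_
    obtain ⟨a, ha, b, hb, e⟩ := hmul g.1 g.2
    exact ⟨⟨a, hN ha⟩, ha, ⟨b, hK hb⟩, hb, Subtype.ext e.symm⟩

/-! ### The semidirect decomposition. -/

namespace NuStructure

open PosRibbon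

variable {N : NuStructure B Δ} {X : PosRibbon B Δ} {ΔX : G}

theorem SHnu_subset : N.SHnu X ⊆ N.SH X := fun _ h => h.1

theorem closure_SHnu_le : Submonoid.closure (N.SHnu X) ≤ Submonoid.closure (N.SH X) :=
  Submonoid.closure_mono SHnu_subset

theorem conjTo_of_mem_subgroup {g : G} (hg : g ∈ Subgroup.closure (N.SH X)) :
    ConjTo g X.carrier X.carrier := by
  induction hg using Subgroup.closure_induction with
  | mem x hx => exact conjTo_of_mem_SH hx
  | one => exact ConjTo.one _
  | mul x y _ _ hx hy => exact hx.mul hy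
  | inv x _ hx => exact hx.inv

namespace Setting

variable (S : Setting N X ΔX δ)
include S

theorem delta_mem_closure_SH : ΔX ∈ Submonoid.closure (N.SH X) :=
  S.mem_closure_SH_of_isFrom S.isFrom_delta (S.carrier_le S.parabolic.delta_mem_self)

theorem delta_leftDivides_delta_sh : LeftDivides B ΔX δ :=
  (S.sh_parabolic.interval_iff S.parabolic.delta_mem).2
    ⟨S.parabolic.delta_dvd, S.carrier_le S.parabolic.delta_mem_self⟩

theorem SH_eq_of_leftDivides {v w : G} (hv : v ∈ N.SH X) (hw : w ∈ N.SH X)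
    (hd : LeftDivides B v w) : v = w := by
  obtain ⟨k, hk, rfl⟩ := S.leftDivides_closure_SH (Submonoid.subset_closure hv)
    (Submonoid.subset_closure hw) hd
  rw [← S.atomSet_closure_SH] at hw
  rcases hw.2.2 v (Submonoid.subset_closure hv) k hk rfl with h | h
  · exact absurd h (SH_ne_one hv)
  · rw [h, mul_one]

/-- If an atom `s` of `X` divides `v`, then `ν_X(s)` divides both `v` and `ΔX`. Shakers are atoms of
their monoid, so `v = ν_X(s)` lies in `X`. -/
theorem SHnu_reduced {v : G} (hv : v ∈ N.SHnu X) : Reduced B X.carrier v := by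
  intro x hx hxv
  by_contra h1
  have hB := S.garside
  have hF := X.factorClosed hB
  obtain ⟨s, hs, hsx⟩ := hB.exists_atom_leftDivides (X.le hx) h1
  have hsX := hF.left hs.1 hx hsx
  have hsh := mem_sh_of_mem_closure hs (S.carrier_le hsX)
  have h₁ := N.left.nu_leftDivides hs
    (S.isFrom_of_mem (Submonoid.subset_closure hv.1)) (hsx.trans hxv)
  have h₂ := N.left.nu_leftDivides hs S.isFrom_delta
    ((S.parabolic.interval_iff hs.1).2 ⟨hB.atom_dvd s hs, hsX⟩)
  have h₃ := hF.left (nu_mem hs) S.parabolic.delta_mem_self h₂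
  exact hv.2 (S.SH_eq_of_leftDivides (nu_mem_SH hsh) hv.1 h₁ ▸ h₃)

/-- Reducedness is multiplicative on elements normalizing `X`. Conversely, a first shaker of a
reduced element cannot lie in `X`, and what follows it is still reduced. -/
theorem mem_closure_SHnu_iff {g : G} : g ∈ Submonoid.closure (N.SHnu X) ↔
    g ∈ Submonoid.closure (N.SH X) ∧ Reduced B X.carrier g := by
  have hB := S.garside
  constructor
  · intro hg
    refine ⟨closure_SHnu_le hg, ?_⟩
    induction hg using Submonoid.closure_induction with
    | mem v hv => exact S.SHnu_reduced hv
    | one => exact fun x hx h => hB.eq_one_of_leftDivides_one (X.le hx) h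
    | mul a b ha hb iha ihb =>
      exact iha.mul hB S.parabolic (S.closure_SH_le_B (closure_SHnu_le ha))
        (conjTo_of_mem_closure_SH (closure_SHnu_le ha))
        (S.closure_SH_le_B (closure_SHnu_le hb)) ihb
  · rintro ⟨hg, hr⟩
    refine S.isGarsideMonoid_closure_SH.atom_induction
      (C := fun g => Reduced B X.carrier g → g ∈ Submonoid.closure (N.SHnu X))
      (fun _ => one_mem _) (fun v hv k hk ih hr => ?_) g hg hr
    rw [S.atomSet_closure_SH] at hv
    have hvM := Submonoid.subset_closure hv
    refine mul_mem (Submonoid.subset_closure ⟨hv, fun hvX => SH_ne_one hv ?_⟩)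
      (ih (hr.right (conjTo_of_mem_SH hv) (S.closure_SH_le_B hvM)))
    exact hr v hvX (leftDivides_mul_right (S.closure_SH_le_B hk))

theorem nabla_mem : ΔX⁻¹ * δ ∈ Submonoid.closure (N.SH X) :=
  leftDivides_iff.1 (S.leftDivides_closure_SH S.delta_mem_closure_SH S.delta_sh_mem
    S.delta_leftDivides_delta_sh)

/-- If `x` divides `∇`, then `ΔX * x` is an element of `X` dividing `Δ`, so it divides `ΔX`. -/
theorem nabla_reduced : Reduced B X.carrier (ΔX⁻¹ * δ) := by
  intro x hx hd
  rw [leftDivides_inv_mul_iff] at hd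
  have hmem : ΔX * x ∈ X.carrier := mul_mem S.parabolic.delta_mem_self hx
  have h := (S.parabolic.interval_iff (X.le hmem)).2 ⟨hd.trans S.sh_parabolic.delta_dvd, hmem⟩
  have h' := S.garside.leftDivides_antisymm h (leftDivides_mul_right (X.le hx))
  simpa using h'

theorem nabla_mem_closure_SHnu : ΔX⁻¹ * δ ∈ Submonoid.closure (N.SHnu X) :=
  S.mem_closure_SHnu_iff.2 ⟨S.nabla_mem, S.nabla_reduced⟩

/-- Right factors of `δ` are left factors of `δ`. -/
theorem leftDivides_delta_of_mul_eq {a b : G} (ha : a ∈ Submonoid.closure (N.SH X))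
    (e : δ = a * b) : LeftDivides (Submonoid.closure (N.SH X)) b δ :=
  S.conjTo_delta_closure_SH.leftDivides_iff_rightDivides.2 ⟨a, ha, e⟩

theorem commute_delta : δ⁻¹ * ΔX * δ = ΔX := by
  have hX := S.parabolic
  have hsh := S.sh_parabolic
  have hc := S.conjTo_delta_sh
  -- conjugates of `ΔX` by `δ` divide `δ`, hence `ΔX`
  have h₀ : ΔX⁻¹ * δ ∈ Submonoid.closure (N.sh X) := S.closure_SH_le S.nabla_mem
  have h₁ : LeftDivides B (δ⁻¹ * ΔX * δ) ΔX := by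
    have hm := hc.mem hX.delta_mem_self
    refine (hX.interval_iff (X.le hm)).2 ⟨LeftDivides.trans (leftDivides_iff.2 ?_) hsh.delta_dvd, hm⟩
    simpa [mul_assoc] using hsh.le (hsh.delta_conj.mem h₀)
  have h₂ : LeftDivides B (δ * ΔX * δ⁻¹) ΔX := by
    have hm := hc.mem' hX.delta_mem_self
    refine (hX.interval_iff (X.le hm)).2 ⟨LeftDivides.trans (leftDivides_iff.2 ?_) hsh.delta_dvd, hm⟩
    simpa [mul_assoc] using hsh.le (hsh.delta_conj.mem' h₀)
  refine S.garside.leftDivides_antisymm h₁ (leftDivides_iff.2 ?_)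
  have h₃ := (X.factorClosed S.garside).quotient (X.le (hc.mem' hX.delta_mem_self))
    hX.delta_mem_self h₂
  simpa [mul_assoc] using X.le (hc.mem h₃)

/-- The lcm of `ΔX` and the reduced `g` is `ΔX * g`, so it divides `δ`. Thus `g⁻¹ * ΔX * g` divides
`g⁻¹ * δ`, a right factor and hence a left factor of `δ`. -/
theorem conj_delta_leftDivides {g : G} (hg : g ∈ Submonoid.closure (N.SHnu X))
    (hd : LeftDivides B g δ) :
    LeftDivides B (ΔX * g) δ ∧ LeftDivides B (g⁻¹ * ΔX * g) ΔX := by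
  obtain ⟨hgM, hr⟩ := S.mem_closure_SHnu_iff.1 hg
  have hgB := S.closure_SH_le_B hgM
  have hc := conjTo_of_mem_closure_SH hgM
  have hX := S.parabolic
  have h₁ := hr.mul_leftDivides S.garside hX hgB hc hX.delta_mem_self S.sh_parabolic.delta_mem
    S.delta_leftDivides_delta_sh hd
  have hm := hc.mem hX.delta_mem_self
  refine ⟨h₁, (hX.interval_iff (X.le hm)).2 ⟨?_, hm⟩⟩
  refine (LeftDivides.trans (b := g⁻¹ * δ) ?_ ?_).trans S.sh_parabolic.delta_dvd
  · rw [mul_assoc]; exact (leftDivides_mul_left_iff _).2 h₁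
  · exact (S.leftDivides_delta_of_mul_eq hgM (by simp)).mono S.closure_SH_le_B

/-- One divisibility is known; the reverse one comes from the complement `h` with `g * h = ∇`. Since
`∇` commutes with `ΔX`, conjugation of `ΔX` by `g⁻¹` on the left is conjugation by `h`, and the
known divisibility for `h` reads backwards. -/
theorem conj_delta_of_leftDivides {g : G} (hg : g ∈ Submonoid.closure (N.SHnu X))
    (hd : LeftDivides B g δ) : g⁻¹ * ΔX * g = ΔX := by
  obtain ⟨h₁, h₂⟩ := S.conj_delta_leftDivides hg hd
  have hgM := closure_SHnu_le hg
  have hgB := S.closure_SH_le_B hgM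
  have hX := S.parabolic
  have hgn : LeftDivides B g (ΔX⁻¹ * δ) := leftDivides_inv_mul_iff.2 h₁
  have hhM : g⁻¹ * (ΔX⁻¹ * δ) ∈ Submonoid.closure (N.SH X) :=
    leftDivides_iff.1 (S.leftDivides_closure_SH hgM S.nabla_mem hgn)
  set h := g⁻¹ * (ΔX⁻¹ * δ) with hh
  have hgh : ΔX⁻¹ * δ = g * h := by simp [hh]
  have hhn : h ∈ Submonoid.closure (N.SHnu X) := S.mem_closure_SHnu_iff.2
    ⟨hhM, Reduced.right (conjTo_of_mem_closure_SH hgM) hgB (hgh ▸ S.nabla_reduced)⟩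
  have h₃ := (S.conj_delta_leftDivides hhn ((S.leftDivides_delta_of_mul_eq
    (mul_mem S.delta_mem_closure_SH hgM) (by simp [hh, mul_assoc])).mono S.closure_SH_le_B)).2
  have hc := conjTo_of_mem_closure_SH hhM
  have h₄ := hc.mem' ((X.factorClosed S.garside).quotient (X.le (hc.mem hX.delta_mem_self))
    hX.delta_mem_self h₃)
  have h₅ : h * ΔX * h⁻¹ = g⁻¹ * ΔX * g := by
    have e : δ * ΔX * δ⁻¹ = ΔX := by
      conv_lhs => rw [← S.commute_delta]
      simp [mul_assoc]
    calc h * ΔX * h⁻¹ = g⁻¹ * ΔX⁻¹ * (δ * ΔX * δ⁻¹) * ΔX * g := by simp [hh, mul_assoc]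
      _ = g⁻¹ * ΔX * g := by rw [e]; simp [mul_assoc]
  refine S.garside.leftDivides_antisymm h₂ (leftDivides_iff.2 ?_)
  rw [← h₅]
  simpa [mul_assoc] using X.le h₄

theorem commute_of_mem_closure_SHnu {g : G} (hg : g ∈ Submonoid.closure (N.SHnu X)) :
    Commute ΔX g := by
  induction hg using Submonoid.closure_induction with
  | mem v hv =>
    have := S.conj_delta_of_leftDivides (Submonoid.subset_closure hv) (S.SH_leftDivides_delta hv.1)
    rw [mul_assoc, inv_mul_eq_iff_eq_mul] at this
    exact this
  | one => exact Commute.one_right _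
  | mul a b _ _ ha hb => exact ha.mul_right hb

theorem conjTo_nabla : ConjTo (ΔX⁻¹ * δ) (Submonoid.closure (N.SHnu X))
    (Submonoid.closure (N.SHnu X)) := by
  have h₁ : ConjTo ΔX (Submonoid.closure (N.SHnu X)) (Submonoid.closure (N.SHnu X)) := fun x => by
    constructor
    · intro hx
      rwa [mul_assoc, ← (S.commute_of_mem_closure_SHnu hx).eq, inv_mul_cancel_left]
    · intro hx
      have := (S.commute_of_mem_closure_SHnu hx).eq
      simp only [← mul_assoc, mul_left_inj, mul_inv_cancel, one_mul] at this
      rwa [← this] at hx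
  -- Conjugation by `δ` and by its inverse preserves the shaker monoid, `X` and divisibility, hence
  -- reducedness.
  have key : ∀ c, ConjTo c (Submonoid.closure (N.sh X)) (Submonoid.closure (N.sh X)) →
      ConjTo c (Submonoid.closure (N.SH X)) (Submonoid.closure (N.SH X)) →
      ConjTo c X.carrier X.carrier → ∀ x ∈ Submonoid.closure (N.SHnu X),
        c⁻¹ * x * c ∈ Submonoid.closure (N.SHnu X) := fun c hc hcM hcX x hx => by
    obtain ⟨hxM, hr⟩ := S.mem_closure_SHnu_iff.1 hx
    refine S.mem_closure_SHnu_iff.2 ⟨hcM.mem hxM, fun z hz hd => ?_⟩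
    have h := hc.mem' (S.factorClosed_sh.quotient (X.le hz) (S.closure_SH_le (hcM.mem hxM)) hd)
    have := hr _ (hcX.mem' hz) (leftDivides_iff.2 (by
      simpa [mul_assoc] using S.sh_parabolic.le h))
    simpa using this
  have hc := S.sh_parabolic.delta_conj
  have hM := S.conjTo_delta_closure_SH
  have hX := S.conjTo_delta_sh
  exact h₁.inv_mul fun x => ⟨key δ hc hM hX x, fun h => by
    simpa [mul_assoc] using key _ hc.inv hM.inv hX.inv _ h⟩

theorem isParabolicWith_closure_SHnu : IsParabolicWith (Submonoid.closure (N.SH X)) δ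
    (Submonoid.closure (N.SHnu X)) (ΔX⁻¹ * δ) := by
  refine IsParabolicWith.of_factorClosed S.isGarsideMonoid_closure_SH closure_SHnu_le ?_
    S.nabla_mem S.conjTo_nabla fun g hg => ⟨fun hd => ⟨hd.trans ?_, ?_⟩, fun ⟨hd, hg'⟩ => ?_⟩
  · intro a ha b hb hab
    have hr := (S.mem_closure_SHnu_iff.1 hab).2
    exact ⟨S.mem_closure_SHnu_iff.2 ⟨ha, hr.left (leftDivides_mul_right (S.closure_SH_le_B hb))⟩,
      S.mem_closure_SHnu_iff.2 ⟨hb, hr.right (conjTo_of_mem_closure_SH ha) (S.closure_SH_le_B ha)⟩⟩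
  · exact S.leftDivides_delta_of_mul_eq S.delta_mem_closure_SH (by simp)
  · exact S.mem_closure_SHnu_iff.2 ⟨hg, S.nabla_reduced.left (hd.mono S.closure_SH_le_B)⟩
  · exact S.leftDivides_closure_SH hg S.nabla_mem
      (leftDivides_inv_mul_iff.2 (S.conj_delta_leftDivides hg' (hd.mono S.closure_SH_le_B)).1)

theorem isInternalSemidirect : IsInternalSemidirect (Subgroup.closure (N.SH X))
    (quasiCentralizer X.carrier) (Subgroup.closure (N.SHnu X)) := by
  have hXG := S.parabolic.isGarsideMonoid S.garside
  have hle : Submonoid.closure (N.SH X) ≤ (Subgroup.closure (N.SH X)).toSubmonoid :=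
    Submonoid.closure_le.2 Subgroup.subset_closure
  have hK : Subgroup.closure (N.SHnu X) ≤ Subgroup.closure (N.SH X) :=
    Subgroup.closure_mono SHnu_subset
  refine isInternalSemidirect_of ?_ hK
    (fun g hg k hk => conj_mem_quasiCentralizer (conjTo_of_mem_subgroup hk) hg) ?_ ?_
  · rintro g ⟨hg, hc⟩
    obtain ⟨a, ha, n, rfl⟩ := hXG.exists_fraction hg
    have hpow := S.parabolic.delta_conj.pow n
    have haM : a ∈ Submonoid.closure (N.SH X) :=
      S.mem_closure_SH_iff.2 ⟨S.carrier_le ha, by simpa using hc.mul hpow⟩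
    exact mul_mem (hle haM) (inv_mem (hle (pow_mem S.delta_mem_closure_SH n)))
  · rintro g ⟨hg, -⟩ hgK
    obtain ⟨c, hc, n, rfl⟩ := hXG.exists_fraction hg
    obtain ⟨a, ha, m, e⟩ :=
      (S.isParabolicWith_closure_SHnu.isGarsideMonoid S.isGarsideMonoid_closure_SH).exists_fraction
        (Subgroup.closure_mono Submonoid.subset_closure hgK)
    have hb := pow_mem S.nabla_mem_closure_SHnu m
    set b := (ΔX⁻¹ * δ) ^ m
    set d := ΔX ^ n with hd
    have hdX : d ∈ X.carrier := pow_mem S.parabolic.delta_mem_self n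
    have hda : Commute d a := (S.commute_of_mem_closure_SHnu ha).pow_left n
    have hdb : Commute d b := (S.commute_of_mem_closure_SHnu hb).pow_left n
    -- Clearing denominators uses that `ΔX` commutes with reduced elements. Comparing `X`-parts, `c`
    -- and `d` divide each other.
    have key : d * a = c * b := by
      rw [mul_inv_eq_iff_eq_mul] at e
      rw [e, hda.eq, mul_assoc, mul_assoc, hdb.eq, inv_mul_cancel_left]
    obtain ⟨haM, har⟩ := S.mem_closure_SHnu_iff.1 ha
    obtain ⟨hbM, hbr⟩ := S.mem_closure_SHnu_iff.1 hb
    have haB := S.closure_SH_le_B haM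
    have hbB := S.closure_SH_le_B hbM
    have h₁ := har.leftDivides_of_mul S.garside S.parabolic haB hc hdX
      (key ▸ leftDivides_mul_right hbB)
    have h₂ := hbr.leftDivides_of_mul S.garside S.parabolic hbB hdX hc
      (key ▸ leftDivides_mul_right haB)
    rw [S.garside.leftDivides_antisymm h₁ h₂, mul_inv_cancel]
  · intro g hg
    have hconj : ∀ k ∈ Subgroup.closure (N.SH X), ∀ a ∈ quasiCentralizer X.carrier,
        k * a * k⁻¹ ∈ quasiCentralizer X.carrier := fun k hk a ha =>
      conj_mem_quasiCentralizer (conjTo_of_mem_subgroup hk) ha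
    induction hg using Subgroup.closure_induction with
    -- A shaker lying in `X` belongs to the quasi-centralizer; any other is in `SHnu`.
    | mem v hv =>
      by_cases hvX : v ∈ X.carrier
      · exact ⟨v, ⟨Subgroup.subset_closure hvX, conjTo_of_mem_SH hv⟩, 1, one_mem _, by simp⟩
      · exact ⟨1, one_mem _, v, Subgroup.subset_closure ⟨hv, hvX⟩, by simp⟩
    | one => exact ⟨1, one_mem _, 1, one_mem _, by simp⟩
    | mul x y _ _ hx hy =>
      obtain ⟨a, ha, b, hb, rfl⟩ := hx
      obtain ⟨a', ha', b', hb', rfl⟩ := hy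
      exact ⟨a * (b * a' * b⁻¹), mul_mem ha (hconj b (hK hb) a' ha'), b * b', mul_mem hb hb',
        by simp [mul_assoc]⟩
    | inv x _ hx =>
      obtain ⟨a, ha, b, hb, rfl⟩ := hx
      refine ⟨b⁻¹ * a⁻¹ * b, ?_, b⁻¹, inv_mem hb, by simp⟩
      simpa using hconj b⁻¹ (inv_mem (hK hb)) a⁻¹ (inv_mem ha)

theorem isStandardParabolicSubgroup :
    IsStandardParabolicSubgroup (Submonoid.closure (N.SH X)) δ (Subgroup.closure (N.SHnu X))
      (Submonoid.closure (N.SHnu X)) (ΔX⁻¹ * δ) := by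
  refine ⟨S.isParabolicWith_closure_SHnu,
    le_antisymm (Subgroup.closure_mono Submonoid.subset_closure) ?_⟩
  rw [Subgroup.closure_le]
  exact (Submonoid.closure_le (S := (Subgroup.closure (N.SHnu X)).toSubmonoid)).2
    Subgroup.subset_closure

end Setting

end NuStructure

end

theorem mainTheorem6 {G : Type*} [Group G]
    -- the Garside group `A = G`, its Garside monoid `Ap` and its Garside element `Δ`
    (Ap : Submonoid G) (Δ : G) (hA : IsGarsideGroup ⊤ Ap Δ)
    (N : NuStructure Ap Δ)
    -- the parabolic submonoid `A_X⁺` and its Garside element `Δ_X`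
    (X : PosRibbon Ap Δ) (ΔX : G) (hX : IsParabolicWith Ap Δ X.carrier ΔX)
    (hsh : N.sh X = N.shTilde X)
    -- the submonoid generated by `sh(X)` is parabolic, with Garside element `Δ_{sh(X)}`
    (Δsh : G) (hpar : IsParabolicWith Ap Δ (Submonoid.closure (N.sh X)) Δsh) :
    -- part (i)
    (∃ 𝓖 : CatGarsideStructure (PosRibbon Ap Δ),
      (∀ P, PosRibbon.elt (𝓖.Δ.app P) = Δ) ∧
      IsStandardParabolicInRibbon 𝓖 X (Subgroup.closure (N.SH X))
        (Submonoid.closure (N.SH X)) Δsh) ∧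
    IsGarsideGroup (Subgroup.closure (N.SH X)) (Submonoid.closure (N.SH X)) Δsh ∧
    atomSet (Submonoid.closure (N.SH X)) = N.SH X ∧
    -- part (ii)
    IsStandardParabolicSubgroup (Submonoid.closure (N.SH X)) Δsh
      (Subgroup.closure (N.SHnu X)) (Submonoid.closure (N.SHnu X)) (ΔX⁻¹ * Δsh) ∧
    IsInternalSemidirect (Subgroup.closure (N.SH X))
      (quasiCentralizer X.carrier) (Subgroup.closure (N.SHnu X)) := by
  have S : N.Setting X ΔX Δsh := ⟨hA.garside, hX, hpar⟩
  exact ⟨⟨PosRibbon.garsideStructure S.garside N.left,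
    PosRibbon.elt_garsideStructure_app S.garside N.left, S.isStandardParabolicInRibbon⟩,
    S.isGarsideGroup_closure_SH, S.atomSet_closure_SH, S.isStandardParabolicSubgroup,
    S.isInternalSemidirect⟩
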